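/- **Theorem 3.3.** There is an algorithm which, given an arbitrary three-monomial equation $$a \prod_{i=1}^n x_i^{\alpha_i} + b \prod_{i=1}^n x_i^{\beta_i} + c \prod_{i=1}^n x_i^{\gamma_i} = 0 \qquad (E)$$ (any number $n\ge 0$ of variables, non-zero integers $a,b,c$, non-negative integer exponents $\alpha_i,\beta_i,\gamma_i$), outputs a finite list $(E_1,\varphi_1),\dots,(E_m,\varphi_m)$ of the following kind. Each $E_j$ is a three-monomial equation with independent monomials, that is, an equation $$A \prod_{i=1}^{n_1} u_i^{e_i} + B \prod_{i=1}^{n_2} v_i^{f_i} + C \prod_{i=1}^{n_3} w_i^{g_i} = 0$$ with non-zero integers $A,B,C$, integers $n_1,n_2,n_3\ge 0$, non-negative integer exponents, and pairwise different variables $u_i,v_i,w_i$ (exponents may be $0$, and $n_1,n_2,n_3$ and all the other data depend on $j$). Each $\varphi_j$ is an explicit monomial substitution $$x_i = t_i \prod_{k=1}^{n_1} u_k^{p_{ik}} \prod_{k=1}^{n_2} v_k^{q_{ik}} \prod_{k=1}^{n_3} w_k^{r_{ik}}, \qquad i=1,\dots,n,$$ with integers $t_i$ (possibly $0$) and non-negative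 integer exponents $p_{ik},q_{ik},r_{ik}$. The set $\mathrm{Sol}(E)$ of all integer solutions of $(E)$ satisfies $$\mathrm{Sol}(E)=\bigcup_{j=1}^m \varphi_j\bigl(\mathrm{Sol}(E_j)\bigr),$$ so that describing all integer solutions of $(E)$ is reduced to the same problem for $E_1,\dots,E_m$. Moreover, it suffices to find only the primitive solutions of the resulting equations, that is, the integer solutions with $\gcd(u_i,v_k)=\gcd(u_i,w_l)=\gcd(v_k,w_l)=1$ for all $i,k,l$: if $\mathrm{Prim}(E_j)$ is the set of primitive solutions of $E_j$, then also $$\mathrm{Sol}(E)=\bigcup_{j=1}^m \varphi_j\bigl(\mathrm{Prim}(E_j)\bigr).$$ Here "algorithm" means a computable function from the finite data $(a,b,c,(\alpha_i,\beta_i,\gamma_i)_i)$ to finite lists. -/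

import Mathlib

namespace ThreeMonomial

/-- The equation `a ∏ xᵢ ^ αᵢ + b ∏ xᵢ ^ βᵢ + c ∏ xᵢ ^ γᵢ = 0` in `n` variables, given by finite
data: its coefficients and, for each variable `xᵢ`, the triple of exponents `(αᵢ, βᵢ, γᵢ)`.
The number `n` of variables is the length of the list. -/
structure Equation where
  a : ℤ
  b : ℤ
  c : ℤ
  exps : List (ℕ × ℕ × ℕ)

namespace Equation

/-- All three coefficients are non-zero, so that there really are three monomials. -/
def Nondegenerate (E : Equation) : Prop := E.a ≠ 0 ∧ E.b ≠ 0 ∧ E.c ≠ 0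

/-- The number of variables. -/
abbrev numVars (E : Equation) : ℕ := E.exps.length

/-- The set of all integer solutions. -/
def solutions (E : Equation) : Set (Fin E.numVars → ℤ) :=
  {x | E.a * ∏ i, x i ^ (E.exps.get i).1 + E.b * ∏ i, x i ^ (E.exps.get i).2.1
    + E.c * ∏ i, x i ^ (E.exps.get i).2.2 = 0}

/-- An equation is the same thing as the tuple of its data. -/
def equivTuple : Equation ≃ ℤ × ℤ × ℤ × List (ℕ × ℕ × ℕ) where
  toFun E := (E.a, E.b, E.c, E.exps)
  invFun t := ⟨t.1, t.2.1, t.2.2.1, t.2.2.2⟩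
  left_inv _ := rfl
  right_inv _ := rfl

instance : Primcodable Equation := Primcodable.ofEquiv _ equivTuple

end Equation

/-- An equation with independent monomials,
`a ∏ xᵢ ^ αᵢ + b ∏ yⱼ ^ βⱼ + c ∏ zₖ ^ γₖ = 0`,
in three disjoint groups of variables `xᵢ`, `yⱼ`, `zₖ`. The numbers of variables in the groups are
the lengths of the three lists of exponents. -/
structure IndepEquation where
  a : ℤ
  b : ℤ
  c : ℤ
  α : List ℕ
  β : List ℕ
  γ : List ℕ

namespace IndepEquation

/-- All three coefficients are non-zero, so that there really are three monomials. -/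
def Nondegenerate (I : IndepEquation) : Prop := I.a ≠ 0 ∧ I.b ≠ 0 ∧ I.c ≠ 0

/-- Integer values `(x, y, z)` of the three groups of variables. -/
abbrev Point (I : IndepEquation) : Type :=
  (Fin I.α.length → ℤ) × (Fin I.β.length → ℤ) × (Fin I.γ.length → ℤ)

/-- The set of all integer solutions. -/
def solutions (I : IndepEquation) : Set I.Point :=
  {s | I.a * ∏ i, s.1 i ^ I.α.get i + I.b * ∏ j, s.2.1 j ^ I.β.get j
    + I.c * ∏ k, s.2.2 k ^ I.γ.get k = 0}

/-- The set of primitive solutions: any two variables from different groups take coprime values. -/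
def primitiveSolutions (I : IndepEquation) : Set I.Point :=
  {s | s ∈ I.solutions ∧ (∀ i j, Int.gcd (s.1 i) (s.2.1 j) = 1) ∧
    (∀ i k, Int.gcd (s.1 i) (s.2.2 k) = 1) ∧ (∀ j k, Int.gcd (s.2.1 j) (s.2.2 k) = 1)}

/-- An equation with independent monomials is the same thing as the tuple of its data. -/
def equivTuple : IndepEquation ≃ ℤ × ℤ × ℤ × List ℕ × List ℕ × List ℕ where
  toFun I := (I.a, I.b, I.c, I.α, I.β, I.γ)
  invFun t := ⟨t.1, t.2.1, t.2.2.1, t.2.2.2.1, t.2.2.2.2.1, t.2.2.2.2.2⟩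
  left_inv _ := rfl
  right_inv _ := rfl

instance : Primcodable IndepEquation := Primcodable.ofEquiv _ equivTuple

end IndepEquation

/-- The monomial `∏ vᵢ ^ lᵢ` in `m` variables; exponents missing in the list `l` are `0`. -/
def monomialValue {m : ℕ} (l : List ℕ) (v : Fin m → ℤ) : ℤ := ∏ i, v i ^ l.getD i 0

/-- One item of the output of a reduction: an equation with independent monomials, together with a
monomial substitution that expresses the variables of the original equation through the variables
of the new one. The `i`-th entry `(t, d, e, f)` of `subst` stands for
`t * ∏ xⱼ ^ dⱼ * ∏ yⱼ ^ eⱼ * ∏ zⱼ ^ fⱼ`; a missing entry stands for `0`. -/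
structure Branch where
  eqn : IndepEquation
  subst : List (ℤ × List ℕ × List ℕ × List ℕ)

namespace Branch

/-- The values of the `n` original variables that the substitution assigns to the values `s` of the
variables of the new equation. -/
def recover (B : Branch) (n : ℕ) (s : B.eqn.Point) : Fin n → ℤ := fun i =>
  let m := B.subst.getD i (0, [], [], [])
  m.1 * monomialValue m.2.1 s.1 * monomialValue m.2.2.1 s.2.1 * monomialValue m.2.2.2 s.2.2

/-- A branch is the same thing as the pair of its data. -/
def equivTuple : Branch ≃ IndepEquation × List (ℤ × List ℕ × List ℕ × List ℕ) where
  toFun B := (B.eqn, B.subst)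
  invFun t := ⟨t.1, t.2⟩
  left_inv _ := rfl
  right_inv _ := rfl

instance : Primcodable Branch := Primcodable.ofEquiv _ equivTuple

end Branch

end ThreeMonomial

/-! Take a solution without zero entries. At every prime `p` the least of the `p`-adic valuations of
the three terms occurs at least twice (`min_factorization_le`), so the vector `v` of valuations of
the `x i` satisfies one of three linear systems, such as `s + β · v = t + γ · v ≤ r + α · v` with
`r`, `s`, `t` the valuations of the coefficients. Its solutions in `ℕ` are bounded vectors plus
combinations of bounded homogeneous solutions, and the bounded vector can be dropped when `p`
divides no coefficient (`exists_cone_decomposition`). Multiplying over the primes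
(`exists_parametrization`) writes `x` as a coefficient vector `t` from an explicit finite box times
monomials in parameters, one for each generator of each system. One system is chosen for each prime,
so parameters of different systems are coprime.

After this substitution a common factor splits off, and each group of parameters remains in one term
only (`subst_three_terms`): the monomials have become independent.

Zero entries of `x` are first replaced by `1`, which leaves the non-zero terms alone, and are
restored by zero entries of `t`. A term vanishes at `x` exactly when it vanishes at `t`. If only two
terms survive, or none, a single group of unconstrained parameters is enough.

The algorithm runs over the whole box of `t` and over all bounded generators. Superfluous choices do
no harm, since the substitution of every branch sends solutions to solutions (`recover_isSolution`).
-/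

namespace ThreeMonomial

/-! ### Primitive recursive arithmetic of integers and lists. -/

section Primrec

variable {σ : Type*} [Primcodable σ]

/-- Even codes belong to the non-negative integers and odd codes to the negative ones; this makes
signs and absolute values readable from codes. -/
theorem encode_int (z : ℤ) :
    Encodable.encode z = if 0 ≤ z then 2 * z.natAbs else 2 * z.natAbs - 1 := by
  cases z with
  | ofNat n => rfl
  | negSucc n =>
    have h : ¬ (0 ≤ Int.negSucc n) := by omega
    rw [if_neg h]
    change 2 * n + 1 = _
    simp only [Int.natAbs_negSucc]
    omega

theorem primrec_natAbs : Primrec Int.natAbs := by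
  refine (Primrec.nat_div.comp (Primrec.succ.comp Primrec.encode) (Primrec.const 2)).of_eq ?_
  intro z
  rw [encode_int]
  split_ifs <;> simp only [Nat.succ_eq_add_one] <;> omega

/-- The parity of the sum of the two codes gives the sign of the product. Zero times a negative
number lands in the odd case, where truncated subtraction still yields the code `0`. -/
theorem primrec_int_mul : Primrec₂ ((· * ·) : ℤ → ℤ → ℤ) := by
  have habs : Primrec fun z : ℤ × ℤ => 2 * (z.1.natAbs * z.2.natAbs) :=
    Primrec.nat_mul.comp (Primrec.const 2) (Primrec.nat_mul.comp
      (primrec_natAbs.comp Primrec.fst) (primrec_natAbs.comp Primrec.snd))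
  have hpar : PrimrecPred fun z : ℤ × ℤ =>
      (Encodable.encode z.1 + Encodable.encode z.2) % 2 = 0 :=
    Primrec.eq.comp (Primrec.nat_mod.comp (Primrec.nat_add.comp
      (Primrec.encode.comp Primrec.fst) (Primrec.encode.comp Primrec.snd)) (Primrec.const 2))
      (Primrec.const 0)
  refine ((Primrec.ofNat ℤ).comp (Primrec.ite hpar habs
    (Primrec.nat_sub.comp habs (Primrec.const 1)))).of_eq ?_
  rintro ⟨x, y⟩
  dsimp only
  rw [← Denumerable.ofNat_encode (x * y)]
  congr 1
  rw [encode_int x, encode_int y, encode_int (x * y), Int.natAbs_mul]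
  rcases eq_or_ne x 0 with rfl | hx
  · simp
  rcases eq_or_ne y 0 with rfl | hy
  · simp
  have hx' := Int.natAbs_pos.2 hx
  have hy' := Int.natAbs_pos.2 hy
  rcases lt_or_gt_of_ne hx with h1 | h1 <;> rcases lt_or_gt_of_ne hy with h2 | h2
  · have := mul_pos_of_neg_of_neg h1 h2
    rw [if_neg (not_le.2 h1), if_neg (not_le.2 h2), if_pos this.le, if_pos (by omega)]
  · have := mul_neg_of_neg_of_pos h1 h2
    rw [if_neg (not_le.2 h1), if_pos h2.le, if_neg (not_le.2 this), if_neg (by omega)]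
  · have := mul_neg_of_pos_of_neg h1 h2
    rw [if_pos h1.le, if_neg (not_le.2 h2), if_neg (not_le.2 this), if_neg (by omega)]
  · have := mul_pos h1 h2
    rw [if_pos h1.le, if_pos h2.le, if_pos this.le, if_pos (by omega)]

theorem primrec_int_pow : Primrec₂ ((· ^ ·) : ℤ → ℕ → ℤ) := by
  refine (Primrec.nat_rec' (f := fun p : ℤ × ℕ => p.2) (g := fun _ => (1 : ℤ))
    (h := fun p q => q.2 * p.1) Primrec.snd (Primrec.const 1)
    (primrec_int_mul.comp (Primrec.snd.comp Primrec.snd)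
      (Primrec.fst.comp Primrec.fst))).of_eq ?_
  rintro ⟨x, n⟩
  dsimp only
  induction n with
  | zero => simp
  | succ n ih => simp only [pow_succ, ih]

theorem primrec_nat_pow : Primrec₂ ((· ^ ·) : ℕ → ℕ → ℕ) :=
  Primrec₂.unpaired'.1 Nat.Primrec.pow

theorem primrec_list_sum : Primrec (List.sum : List ℕ → ℕ) := by
  refine (Primrec.list_foldr (f := id) (g := fun _ => 0) (h := fun _ p => p.1 + p.2)
    Primrec.id (Primrec.const 0) (Primrec.nat_add.comp (Primrec.fst.comp Primrec.snd)
      (Primrec.snd.comp Primrec.snd))).of_eq ?_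
  intro l
  simp [List.sum]

theorem primrec_list_prod : Primrec (List.prod : List ℤ → ℤ) := by
  refine (Primrec.list_foldr (f := id) (g := fun _ => 1) (h := fun _ p => p.1 * p.2)
    Primrec.id (Primrec.const 1) (primrec_int_mul.comp (Primrec.fst.comp Primrec.snd)
      (Primrec.snd.comp Primrec.snd))).of_eq ?_
  intro l
  simp [List.prod]

end Primrec

/-! ### The reduction algorithm. -/

/-- The scalar product of two vectors of length `n` given by lists. -/
def dot (n : ℕ) (l m : List ℕ) : ℕ :=
  ((List.range n).map fun i => l.getD i 0 * m.getD i 0).sum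

/-- The value of the monomial with coefficient `c` and exponents `l` at the point `t`. -/
def termValue (n : ℕ) (c : ℤ) (t : List ℤ) (l : List ℕ) : ℤ :=
  c * ((List.range n).map fun i => t.getD i 0 ^ l.getD i 0).prod

/-- All lists of length `n` with entries at most `K`. -/
def box (K n : ℕ) : List (List ℕ) :=
  n.rec [[]] fun _ L => L.flatMap fun l => (List.range (K + 1)).map fun k => k :: l

/-- The vectors `g` in the box with `β · g = γ · g ≤ α · g`. -/
def gens (K n : ℕ) (α β γ : List ℕ) : List (List ℕ) :=
  (box K n).flatMap fun g =>
    if dot n β g = dot n γ g ∧ dot n β g ≤ dot n α g then [g] else []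

/-- The exponents with which the parameters attached to `G` enter the reduced equation. -/
def gapExps (n : ℕ) (α β : List ℕ) (G : List (List ℕ)) : List ℕ :=
  G.map fun g => dot n α g - dot n β g

/-- The monomial substitution with coefficients `t` and exponent vectors `G`, `H`, `L`. -/
def substList (n : ℕ) (t : List ℤ) (G H L : List (List ℕ)) :
    List (ℤ × List ℕ × List ℕ × List ℕ) :=
  (List.range n).map fun i => (t.getD i 0, G.map fun g => g.getD i 0,
    H.map fun g => g.getD i 0, L.map fun g => g.getD i 0)

/-- The branch in which all three monomials survive. -/
def fullBranch (K n : ℕ) (p q r : ℤ) (t : List ℤ) (α β γ : List ℕ) : Branch :=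
  ⟨⟨p, q, r, gapExps n α β (gens K n α β γ), gapExps n β α (gens K n β α γ),
    gapExps n γ α (gens K n γ α β)⟩,
    substList n t (gens K n α β γ) (gens K n β α γ) (gens K n γ α β)⟩

/-- The branch in which the parameters are unconstrained as soon as `p + q + r = 0`. -/
def freeBranch (K n : ℕ) (p q r : ℤ) (t : List ℤ) (α β : List ℕ) : Branch :=
  ⟨⟨p, q, r, gapExps n α α (gens K n α α β), [], []⟩, substList n t (gens K n α α β) [] []⟩

/-- The branches with coefficient vector `t`. In the cases of exactly two surviving monomials the
equation `p + q = 0` is written as `2 p + q - p = 0`. -/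
def branchesAt (K n : ℕ) (p q r : ℤ) (t : List ℤ) (α β γ : List ℕ) : List Branch :=
  if p = 0 then
    if q = 0 then
      if r = 0 then [freeBranch K n 1 1 (-2) t α α] else []
    else if r = 0 then [] else [freeBranch K n (2 * q) r (-1 * q) t β γ]
  else
    if q = 0 then
      if r = 0 then [] else [freeBranch K n (2 * p) r (-1 * p) t α γ]
    else if r = 0 then [freeBranch K n (2 * p) q (-1 * p) t α β]
      else [fullBranch K n p q r t α β γ]

/-- All integer lists of length `n` whose entries have codes at most `T`. -/
def intBox (T n : ℕ) : List (List ℤ) := (box T n).map fun l => l.map (Denumerable.ofNat ℤ)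

/-- Bound for the entries of generators and of minimal solutions: `D` bounds the exponents,
`N` the valuations of the coefficients, `n` is the number of variables. -/
def vecBound (D N n : ℕ) : ℕ :=
  (N + n * D ^ 2) +
    (D + 1) ^ n * ((N + n * (N + n * D ^ 2) * D) + ((D + 1) ^ n + 1) * (n * D ^ 2 + 1) ^ 2) * D +
    (D + 1) ^ n * (n * D ^ 2 + 1) * D

/-- A positive bound for all exponents of the equation. -/
def expBound (E : Equation) : ℕ :=
  (E.exps.map fun e => e.1 + e.2.1 + e.2.2).sum + 1

/-- The product of the absolute values of the coefficients. -/
def coeffNorm (E : Equation) : ℕ := E.a.natAbs * E.b.natAbs * E.c.natAbs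

/-- The bound for vectors of valuations used in the reduction of `E`. -/
def eqnBound (E : Equation) : ℕ := vecBound (expBound E) (coeffNorm E) E.numVars

/-- The reduction of a three-monomial equation to equations with independent monomials. -/
def reduce (E : Equation) : List Branch :=
  (intBox (2 * coeffNorm E ^ eqnBound E) E.numVars).flatMap fun t =>
    branchesAt (eqnBound E) E.numVars
      (termValue E.numVars E.a t (E.exps.map fun e => e.1))
      (termValue E.numVars E.b t (E.exps.map fun e => e.2.1))
      (termValue E.numVars E.c t (E.exps.map fun e => e.2.2)) t
      (E.exps.map fun e => e.1) (E.exps.map fun e => e.2.1) (E.exps.map fun e => e.2.2)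

/-! ### The reduction is primitive recursive. -/

section Primrec

variable {σ : Type*} [Primcodable σ] {K n : σ → ℕ} {l m α β γ : σ → List ℕ} {t : σ → List ℤ}
  {p q r : σ → ℤ} {G H L : σ → List (List ℕ)}

theorem primrec_dot (hn : Primrec n) (hl : Primrec l) (hm : Primrec m) :
    Primrec fun a => dot (n a) (l a) (m a) :=
  primrec_list_sum.comp (Primrec.list_map (Primrec.list_range.comp hn)
    (Primrec.nat_mul.comp
      ((Primrec.list_getD 0).comp (hl.comp Primrec.fst) Primrec.snd)
      ((Primrec.list_getD 0).comp (hm.comp Primrec.fst) Primrec.snd)))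

theorem primrec_termValue (hn : Primrec n) (hp : Primrec p) (ht : Primrec t) (hl : Primrec l) :
    Primrec fun a => termValue (n a) (p a) (t a) (l a) :=
  primrec_int_mul.comp hp (primrec_list_prod.comp (Primrec.list_map (Primrec.list_range.comp hn)
    (primrec_int_pow.comp
      ((Primrec.list_getD 0).comp (ht.comp Primrec.fst) Primrec.snd)
      ((Primrec.list_getD 0).comp (hl.comp Primrec.fst) Primrec.snd))))

theorem primrec_box (hK : Primrec K) (hn : Primrec n) : Primrec fun a => box (K a) (n a) := by
  refine Primrec.nat_rec' (f := n) (g := fun _ => [[]]) (h := fun a p =>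
    p.2.flatMap fun l => (List.range (K a + 1)).map fun k => k :: l) hn (Primrec.const _) ?_
  refine Primrec.list_flatMap (Primrec.snd.comp Primrec.snd) ?_
  refine Primrec.list_map (Primrec.list_range.comp (Primrec.succ.comp
    (hK.comp (Primrec.fst.comp Primrec.fst)))) ?_
  exact Primrec.list_cons.comp Primrec.snd (Primrec.snd.comp Primrec.fst)

theorem primrec_gens (hK : Primrec K) (hn : Primrec n) (hα : Primrec α) (hβ : Primrec β)
    (hγ : Primrec γ) : Primrec fun a => gens (K a) (n a) (α a) (β a) (γ a) := by
  have hd : ∀ {l : σ → List ℕ}, Primrec l →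
      Primrec fun x : σ × List ℕ => dot (n x.1) (l x.1) x.2 := fun hl =>
    primrec_dot (hn.comp Primrec.fst) (hl.comp Primrec.fst) Primrec.snd
  refine Primrec.list_flatMap (primrec_box hK hn) ?_
  refine Primrec.ite ?_ (Primrec.list_cons.comp Primrec.snd (Primrec.const [])) (Primrec.const [])
  exact (Primrec.eq.comp (hd hβ) (hd hγ)).and (Primrec.nat_le.comp (hd hβ) (hd hα))

theorem primrec_gapExps (hn : Primrec n) (hα : Primrec α) (hβ : Primrec β) (hG : Primrec G) :
    Primrec fun a => gapExps (n a) (α a) (β a) (G a) :=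
  Primrec.list_map hG (Primrec.nat_sub.comp
    (primrec_dot (hn.comp Primrec.fst) (hα.comp Primrec.fst) Primrec.snd)
    (primrec_dot (hn.comp Primrec.fst) (hβ.comp Primrec.fst) Primrec.snd))

theorem primrec_substList (hn : Primrec n) (ht : Primrec t) (hG : Primrec G) (hH : Primrec H)
    (hL : Primrec L) : Primrec fun a => substList (n a) (t a) (G a) (H a) (L a) := by
  have hmap : ∀ {G : σ → List (List ℕ)}, Primrec G →
      Primrec fun x : σ × ℕ => (G x.1).map fun g => g.getD x.2 0 := fun hG =>
    Primrec.list_map (hG.comp Primrec.fst)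
      ((Primrec.list_getD 0).comp Primrec.snd (Primrec.snd.comp Primrec.fst))
  refine Primrec.list_map (Primrec.list_range.comp hn) ?_
  exact Primrec.pair ((Primrec.list_getD 0).comp (ht.comp Primrec.fst) Primrec.snd)
    (Primrec.pair (hmap hG) (Primrec.pair (hmap hH) (hmap hL)))

theorem primrec_branch (hp : Primrec p) (hq : Primrec q) (hr : Primrec r) (hα : Primrec α)
    (hβ : Primrec β) (hγ : Primrec γ) {s : σ → List (ℤ × List ℕ × List ℕ × List ℕ)}
    (hs : Primrec s) :
    Primrec fun a => (⟨⟨p a, q a, r a, α a, β a, γ a⟩, s a⟩ : Branch) := by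
  have hI : Primrec fun a => (⟨p a, q a, r a, α a, β a, γ a⟩ : IndepEquation) :=
    (Primrec.of_equiv_symm (e := IndepEquation.equivTuple)).comp
      (hp.pair (hq.pair (hr.pair (hα.pair (hβ.pair hγ)))))
  exact (Primrec.of_equiv_symm (e := Branch.equivTuple)).comp (hI.pair hs)

theorem primrec_fullBranch (hK : Primrec K) (hn : Primrec n) (hp : Primrec p) (hq : Primrec q)
    (hr : Primrec r) (ht : Primrec t) (hα : Primrec α) (hβ : Primrec β) (hγ : Primrec γ) :
    Primrec fun a => fullBranch (K a) (n a) (p a) (q a) (r a) (t a) (α a) (β a) (γ a) := by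
  have h1 := primrec_gens hK hn hα hβ hγ
  have h2 := primrec_gens hK hn hβ hα hγ
  have h3 := primrec_gens hK hn hγ hα hβ
  exact primrec_branch hp hq hr (primrec_gapExps hn hα hβ h1) (primrec_gapExps hn hβ hα h2)
    (primrec_gapExps hn hγ hα h3) (primrec_substList hn ht h1 h2 h3)

theorem primrec_freeBranch (hK : Primrec K) (hn : Primrec n) (hp : Primrec p) (hq : Primrec q)
    (hr : Primrec r) (ht : Primrec t) (hα : Primrec α) (hβ : Primrec β) :
    Primrec fun a => freeBranch (K a) (n a) (p a) (q a) (r a) (t a) (α a) (β a) := by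
  have h1 := primrec_gens hK hn hα hα hβ
  exact primrec_branch hp hq hr (primrec_gapExps hn hα hα h1) (Primrec.const [])
    (Primrec.const []) (primrec_substList hn ht h1 (Primrec.const []) (Primrec.const []))

theorem primrec_branchesAt (hK : Primrec K) (hn : Primrec n) (hp : Primrec p) (hq : Primrec q)
    (hr : Primrec r) (ht : Primrec t) (hα : Primrec α) (hβ : Primrec β) (hγ : Primrec γ) :
    Primrec fun a => branchesAt (K a) (n a) (p a) (q a) (r a) (t a) (α a) (β a) (γ a) := by
  have hz : ∀ {p : σ → ℤ}, Primrec p → PrimrecPred fun a => p a = 0 := fun hp =>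
    Primrec.eq.comp hp (Primrec.const 0)
  have hs : ∀ {B : σ → Branch}, Primrec B → Primrec fun a => [B a] := fun hB =>
    Primrec.list_cons.comp hB (Primrec.const [])
  have hm : ∀ (k : ℤ) {p : σ → ℤ}, Primrec p → Primrec fun a => k * p a := fun k _ hp =>
    primrec_int_mul.comp (Primrec.const k) hp
  have hnil : Primrec fun _ : σ => ([] : List Branch) := Primrec.const []
  exact Primrec.ite (hz hp)
    (Primrec.ite (hz hq)
      (Primrec.ite (hz hr) (hs (primrec_freeBranch hK hn (Primrec.const 1) (Primrec.const 1)
        (Primrec.const (-2)) ht hα hα)) hnil)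
      (Primrec.ite (hz hr) hnil
        (hs (primrec_freeBranch hK hn (hm 2 hq) hr (hm (-1) hq) ht hβ hγ))))
    (Primrec.ite (hz hq)
      (Primrec.ite (hz hr) hnil
        (hs (primrec_freeBranch hK hn (hm 2 hp) hr (hm (-1) hp) ht hα hγ)))
      (Primrec.ite (hz hr) (hs (primrec_freeBranch hK hn (hm 2 hp) hq (hm (-1) hp) ht hα hβ))
        (hs (primrec_fullBranch hK hn hp hq hr ht hα hβ hγ))))

theorem primrec_intBox (hK : Primrec K) (hn : Primrec n) :
    Primrec fun a => intBox (K a) (n a) :=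
  Primrec.list_map (primrec_box hK hn)
    (Primrec.list_map Primrec.snd ((Primrec.ofNat ℤ).comp Primrec.snd))

theorem primrec_vecBound {D N : σ → ℕ} (hD : Primrec D) (hN : Primrec N) (hn : Primrec n) :
    Primrec fun a => vecBound (D a) (N a) (n a) := by
  have hadd : ∀ {f g : σ → ℕ}, Primrec f → Primrec g → Primrec fun a => f a + g a :=
    fun hf hg => Primrec.nat_add.comp hf hg
  have hmul : ∀ {f g : σ → ℕ}, Primrec f → Primrec g → Primrec fun a => f a * g a :=
    fun hf hg => Primrec.nat_mul.comp hf hg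
  have hpow : ∀ {f g : σ → ℕ}, Primrec f → Primrec g → Primrec fun a => f a ^ g a :=
    fun hf hg => primrec_nat_pow.comp hf hg
  have cst : ∀ k : ℕ, Primrec fun _ : σ => k := Primrec.const
  have h1 := hadd hN (hmul hn (hpow hD (cst 2)))
  have h2 := hpow (hadd hD (cst 1)) hn
  have h3 := hadd (hmul hn (hpow hD (cst 2))) (cst 1)
  exact hadd (hadd h1 (hmul (hmul h2 (hadd (hadd hN (hmul (hmul hn h1) hD))
    (hmul (hadd h2 (cst 1)) (hpow h3 (cst 2))))) hD)) (hmul (hmul h2 h3) hD)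

theorem primrec_equation_toTuple : Primrec fun E : Equation => (E.a, E.b, E.c, E.exps) :=
  Primrec.of_equiv (e := Equation.equivTuple)

theorem primrec_reduce : Primrec reduce := by
  have ha : Primrec Equation.a := Primrec.fst.comp primrec_equation_toTuple
  have hb : Primrec Equation.b :=
    Primrec.fst.comp (Primrec.snd.comp primrec_equation_toTuple)
  have hc : Primrec Equation.c :=
    Primrec.fst.comp (Primrec.snd.comp (Primrec.snd.comp primrec_equation_toTuple))
  have he : Primrec Equation.exps :=
    Primrec.snd.comp (Primrec.snd.comp (Primrec.snd.comp primrec_equation_toTuple))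
  have hn : Primrec Equation.numVars := Primrec.list_length.comp he
  have h1 : Primrec fun e : ℕ × ℕ × ℕ => e.1 := Primrec.fst
  have h2 : Primrec fun e : ℕ × ℕ × ℕ => e.2.1 := Primrec.fst.comp Primrec.snd
  have h3 : Primrec fun e : ℕ × ℕ × ℕ => e.2.2 := Primrec.snd.comp Primrec.snd
  have hα : Primrec fun E : Equation => E.exps.map fun e => e.1 :=
    Primrec.list_map he (h1.comp Primrec.snd)
  have hβ : Primrec fun E : Equation => E.exps.map fun e => e.2.1 :=
    Primrec.list_map he (h2.comp Primrec.snd)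
  have hγ : Primrec fun E : Equation => E.exps.map fun e => e.2.2 :=
    Primrec.list_map he (h3.comp Primrec.snd)
  have hD : Primrec expBound := Primrec.succ.comp (primrec_list_sum.comp (Primrec.list_map he
    (Primrec.nat_add.comp (Primrec.nat_add.comp (h1.comp Primrec.snd) (h2.comp Primrec.snd))
      (h3.comp Primrec.snd))))
  have hN : Primrec coeffNorm := Primrec.nat_mul.comp (Primrec.nat_mul.comp
    (primrec_natAbs.comp ha) (primrec_natAbs.comp hb)) (primrec_natAbs.comp hc)
  have hK : Primrec eqnBound := primrec_vecBound hD hN hn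
  refine Primrec.list_flatMap (primrec_intBox
    (Primrec.nat_mul.comp (Primrec.const 2) (primrec_nat_pow.comp hN hK)) hn) ?_
  have f : Primrec (Prod.fst : Equation × List ℤ → Equation) := Primrec.fst
  have s : Primrec (Prod.snd : Equation × List ℤ → List ℤ) := Primrec.snd
  exact primrec_branchesAt (hK.comp f) (hn.comp f)
    (primrec_termValue (hn.comp f) (ha.comp f) s (hα.comp f))
    (primrec_termValue (hn.comp f) (hb.comp f) s (hβ.comp f))
    (primrec_termValue (hn.comp f) (hc.comp f) s (hγ.comp f)) s
    (hα.comp f) (hβ.comp f) (hγ.comp f)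

end Primrec

open Finset

/-! ### Bounded decompositions of the solutions of linear systems in `ℕ`. -/

section Combination

variable {ι κ : Type*} [Fintype κ]

theorem combination_add_single [DecidableEq κ] (G : κ → ι → ℕ) (y : κ → ℕ) (k : κ) :
    ∑ j, (y + Pi.single k 1 : κ → ℕ) j • G j = ∑ j, y j • G j + G k := by
  simp [add_smul, sum_add_distrib, Pi.single_apply, ite_smul]

theorem combination_apply_le (G : κ → ι → ℕ) (y : κ → ℕ) {A B C : ℕ}
    (hcard : Fintype.card κ ≤ A) (hy : ∀ k, y k ≤ B) (hG : ∀ k i, G k i ≤ C) (i : ι) :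
    (∑ k, y k • G k) i ≤ A * B * C := by
  simp only [Finset.sum_apply, Pi.smul_apply, smul_eq_mul]
  refine (sum_le_card_nsmul univ _ (B * C) fun k _ => Nat.mul_le_mul (hy k) (hG k i)).trans ?_
  rw [card_univ, smul_eq_mul, mul_assoc]
  exact Nat.mul_le_mul_right _ hcard

end Combination

section Decomposition

variable {ι κ : Type*} [Fintype ι] [Fintype κ]

/-- Each summand is at least `-D ^ 2`, so a positive one cannot exceed `N` by more than the others
can cancel. -/
theorem le_of_small_negative_part (w : ι → ℤ) {D N : ℕ} (hD : 1 ≤ D) (hw : ∀ i, |w i| ≤ D)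
    {z : ι → ℕ} (hz : ∑ i, w i * z i ≤ N) (h0 : ∀ i, w i = 0 → z i = 0)
    (hneg : ∀ i, w i < 0 → z i ≤ D) (i : ι) : z i ≤ N + Fintype.card ι * D ^ 2 := by
  have hcard : 1 ≤ Fintype.card ι := Fintype.card_pos_iff.2 ⟨i⟩
  have hDD : D ≤ Fintype.card ι * D ^ 2 := by nlinarith
  rcases lt_trichotomy (w i) 0 with h | h | h
  · have := hneg i h
    omega
  · rw [h0 i h]
    exact Nat.zero_le _
  · have hnn : ∀ j ∈ univ, 0 ≤ w j * z j + (D : ℤ) ^ 2 := by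
      intro j _
      have h1 := abs_le.1 (hw j)
      rcases le_or_gt 0 (w j) with h2 | h2
      · positivity
      · have h3 : (z j : ℤ) ≤ D := by exact_mod_cast hneg j h2
        nlinarith [Int.natCast_nonneg (z j)]
    have h1 := single_le_sum hnn (mem_univ i)
    rw [sum_add_distrib, sum_const, card_univ, nsmul_eq_mul] at h1
    have h2 : (z i : ℤ) ≤ w i * z i := by nlinarith [Int.natCast_nonneg (z i)]
    zify
    nlinarith [sq_nonneg (D : ℤ)]

/-- A coordinate of weight `0` in the support of `z` gives a unit vector. Otherwise a large entry
forces entries above `D` at some `i` of positive and some `j` of negative weight, and `|w j| e_i +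
|w i| e_j` lies in the kernel. -/
theorem exists_small_kernel_vector (w : ι → ℤ) {D N : ℕ} (hD : 1 ≤ D) (hw : ∀ i, |w i| ≤ D)
    {z : ι → ℕ} (hz : |∑ i, w i * z i| ≤ N) {i₀ : ι}
    (hi₀ : N + Fintype.card ι * D ^ 2 < z i₀) :
    ∃ g : ι → ℕ, g ≤ z ∧ g ≠ 0 ∧ (∀ i, g i ≤ D) ∧ ∑ i, w i * g i = 0 := by
  classical
  by_cases h0 : ∃ i, w i = 0 ∧ z i ≠ 0
  · obtain ⟨i, hi, hzi⟩ := h0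
    refine ⟨Pi.single i 1, ?_, by simp, ?_, ?_⟩
    · intro j
      rcases eq_or_ne j i with rfl | hj
      · simpa using Nat.one_le_iff_ne_zero.2 hzi
      · simp [hj]
    · intro j
      rcases eq_or_ne j i with rfl | hj
      · simpa using hD
      · simp [hj]
    · refine sum_eq_zero fun j _ => ?_
      rcases eq_or_ne j i with rfl | hj
      · simp [hi]
      · simp [hj]
  push Not at h0
  by_cases hneg : ∀ i, w i < 0 → z i ≤ D
  · exact absurd (le_of_small_negative_part w hD hw (abs_le.1 hz).2 h0 hneg i₀) (not_le.2 hi₀)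
  by_cases hpos : ∀ i, 0 < w i → z i ≤ D
  · refine absurd (le_of_small_negative_part (fun i => -w i) hD (by simpa using hw) (z := z) ?_
      (by simpa using h0) (by simpa using hpos) i₀) (not_le.2 hi₀)
    have := (abs_le.1 hz).1
    simp only [neg_mul, sum_neg_distrib]
    linarith
  push Not at hneg hpos
  obtain ⟨j, hj, hzj⟩ := hneg
  obtain ⟨i, hi, hzi⟩ := hpos
  have hij : i ≠ j := by
    rintro rfl
    omega
  have hwi := hw i
  have hwj := hw j
  rw [abs_of_pos hi] at hwi
  rw [abs_of_neg hj] at hwj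
  refine ⟨Pi.single i (w j).natAbs + Pi.single j (w i).natAbs, ?_, ?_, ?_, ?_⟩
  · intro k
    rcases eq_or_ne k i with rfl | hk
    · simp [hij]
      omega
    rcases eq_or_ne k j with rfl | hk'
    · simp [hk]
      omega
    · simp [hk, hk']
  · intro h
    have := congrFun h i
    simp [hij] at this
    omega
  · intro k
    rcases eq_or_ne k i with rfl | hk
    · simp [hij]
      omega
    rcases eq_or_ne k j with rfl | hk'
    · simp [hk]
      omega
    · simp [hk, hk']
  · simp only [Pi.add_apply, Nat.cast_add, mul_add, sum_add_distrib]
    rw [sum_eq_single i (by intro k _ hk; simp [hk]) (by simp),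
      sum_eq_single j (by intro k _ hk; simp [hk]) (by simp)]
    simp only [Pi.single_eq_same, Int.natCast_natAbs, abs_of_pos hi, abs_of_neg hj]
    ring

/-- If large vectors with property `P` can be diminished by one of the `G k`, then every vector
with property `P` is a bounded one plus a combination of the `G k`. -/
theorem exists_bounded_add_combination (G : κ → ι → ℕ) (P : (ι → ℕ) → Prop) (K : ℕ)
    (hstep : ∀ v, P v → ∀ i, K < v i → ∃ k, G k ≤ v ∧ G k ≠ 0 ∧ P (v - G k))
    (v : ι → ℕ) (hv : P v) :
    ∃ (v₀ : ι → ℕ) (y : κ → ℕ), P v₀ ∧ (∀ i, v₀ i ≤ K) ∧ v = v₀ + ∑ k, y k • G k := by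
  classical
  induction hs : ∑ i, v i using Nat.strong_induction_on generalizing v with
  | _ s ih =>
    by_cases h : ∃ i, K < v i
    · obtain ⟨i, hi⟩ := h
      obtain ⟨k, hk, hk0, hP⟩ := hstep v hv i hi
      have hsum : ∑ i, (v - G k) i + ∑ i, G k i = ∑ i, v i := by
        rw [← sum_add_distrib]
        exact sum_congr rfl fun i _ => Nat.sub_add_cancel (hk i)
      have hpos : 0 < ∑ i, G k i := by
        rw [Nat.pos_iff_ne_zero]
        intro h0
        apply hk0
        funext i
        exact (sum_eq_zero_iff.1 h0) i (mem_univ i)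
      obtain ⟨v₀, y, h0, h1, h2⟩ := ih _ (by omega) (v - G k) hP rfl
      refine ⟨v₀, y + Pi.single k 1, h0, h1, ?_⟩
      rw [combination_add_single, ← add_assoc, ← h2]
      funext i
      exact (Nat.sub_add_cancel (hk i)).symm
    · push Not at h
      exact ⟨v, 0, hv, h, by simp⟩

theorem sum_mul_combination (w : ι → ℤ) (G : κ → ι → ℕ) (y : κ → ℕ) :
    ∑ i, w i * ((∑ k, y k • G k) i : ℕ) = ∑ k, (∑ i, w i * G k i) * y k := by
  simp only [Finset.sum_apply, Pi.smul_apply, smul_eq_mul, Nat.cast_sum, Nat.cast_mul, mul_sum,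
    sum_mul]
  rw [sum_comm]
  exact sum_congr rfl fun k _ => sum_congr rfl fun i _ => by ring

theorem abs_sum_mul_le (w : ι → ℤ) {D B : ℕ} (hw : ∀ i, |w i| ≤ D) {z : ι → ℕ}
    (hz : ∀ i, z i ≤ B) : |∑ i, w i * z i| ≤ (Fintype.card ι * B * D : ℕ) := by
  refine (abs_sum_le_sum_abs _ _).trans ?_
  refine (sum_le_card_nsmul univ _ ((B * D : ℕ) : ℤ) fun i _ => ?_).trans ?_
  · rw [abs_mul, Nat.abs_cast, mul_comm, Nat.cast_mul]
    have := hz i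
    exact mul_le_mul (by exact_mod_cast this) (hw i) (abs_nonneg _) (by positivity)
  · rw [card_univ, nsmul_eq_mul]
    push_cast
    exact le_of_eq (by ring)

/-- Subtracting a bounded kernel vector from a large solution of `δ · v = d`, `ε · v ≥ e`. -/
theorem exists_small_cone_vector (δ ε : ι → ℤ) {d e : ℤ} {D N : ℕ} (hD : 1 ≤ D)
    (hδ : ∀ i, |δ i| ≤ D) (hε : ∀ i, |ε i| ≤ D) (hd : |d| ≤ N) (he : |e| ≤ N) {v : ι → ℕ}
    (hv : ∑ i, δ i * v i = d) (hv' : e ≤ ∑ i, ε i * v i) {i₀ : ι}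
    (hi₀ : vecBound D N (Fintype.card ι) < v i₀) :
    ∃ g : ι → ℕ, g ≤ v ∧ g ≠ 0 ∧ (∀ i, g i ≤ vecBound D N (Fintype.card ι)) ∧
      ∑ i, δ i * g i = 0 ∧ 0 ≤ ∑ i, ε i * g i ∧ ∑ i, ε i * g i ≤ ∑ i, ε i * v i - e := by
  classical
  -- The equation is handled first: `v` is a bounded vector plus a combination of non-zero kernel
  -- vectors of `δ` with entries at most `D`.
  let κ := {g : ι → Fin (D + 1) // (fun i => (g i : ℕ)) ≠ 0 ∧ ∑ i, δ i * ((g i : ℕ) : ℤ) = 0}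
  let G : κ → ι → ℕ := fun k i => k.1 i
  have hGD : ∀ k i, G k i ≤ D := fun k i => Nat.lt_succ_iff.1 (k.1 i).2
  have hκ : Fintype.card κ ≤ (D + 1) ^ Fintype.card ι := by
    refine (Fintype.card_subtype_le _).trans ?_
    simp
  obtain ⟨v₀, y, -, hv₀, hvy⟩ := exists_bounded_add_combination G
    (fun v => ∑ i, δ i * v i = d) (N + Fintype.card ι * D ^ 2) (by
      intro v hv i hi
      obtain ⟨g, hg, hg0, hgD, hgs⟩ := exists_small_kernel_vector δ hD hδ (by rwa [hv]) hi
      refine ⟨⟨fun i => ⟨g i, Nat.lt_succ_iff.2 (hgD i)⟩, hg0, hgs⟩, hg, hg0, ?_⟩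
      have hsub : ∑ i, δ i * ((v - g) i : ℕ) = ∑ i, δ i * v i - ∑ i, δ i * g i := by
        rw [← sum_sub_distrib]
        refine sum_congr rfl fun i _ => ?_
        rw [Pi.sub_apply, Nat.cast_sub (hg i)]
        exact mul_sub _ _ _
      rw [hgs, sub_zero, hv] at hsub
      exact hsub) v hv
  -- A slack variable (`none`) turns the inequality into an equation for the coefficients `y`. A
  -- kernel vector `h` of `w` below `z` then gives `g = ∑ h k • G k` with `ε · g = h none`, which
  -- lies between `0` and the slack of `v`.
  let w : Option κ → ℤ := fun o => o.elim (-1) fun k => ∑ i, ε i * G k i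
  let z : Option κ → ℕ := fun o => o.elim (∑ i, ε i * v i - e).toNat y
  have hslack : ((∑ i, ε i * v i - e).toNat : ℤ) = ∑ i, ε i * v i - e :=
    Int.toNat_of_nonneg (by linarith)
  have hεv : ∑ i, ε i * v i = ∑ i, ε i * v₀ i + ∑ k, (∑ i, ε i * G k i) * y k := by
    rw [← sum_mul_combination, ← sum_add_distrib]
    refine sum_congr rfl fun i _ => ?_
    rw [← mul_add, ← Nat.cast_add, ← Pi.add_apply, ← hvy]
  have hw : ∀ o, |w o| ≤ (Fintype.card ι * D ^ 2 + 1 : ℕ) := by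
    rintro (_ | k)
    · simp only [w, Option.elim_none, abs_neg, abs_one]
      push_cast
      nlinarith [sq_nonneg (D : ℤ), Int.natCast_nonneg (Fintype.card ι)]
    · have := abs_sum_mul_le ε hε (hGD k)
      refine this.trans ?_
      push_cast
      nlinarith
  have hwz : ∑ o, w o * z o = e - ∑ i, ε i * v₀ i := by
    rw [Fintype.sum_option]
    simp only [w, z, Option.elim_none, Option.elim_some, hslack]
    linarith
  have hwz' : |∑ o, w o * z o| ≤
      (N + Fintype.card ι * (N + Fintype.card ι * D ^ 2) * D : ℕ) := by
    rw [hwz, Nat.cast_add]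
    exact (abs_sub _ _).trans (add_le_add he (abs_sum_mul_le ε hε hv₀))
  have hbig : ∃ k, (N + Fintype.card ι * (N + Fintype.card ι * D ^ 2) * D) +
      ((D + 1) ^ Fintype.card ι + 1) * (Fintype.card ι * D ^ 2 + 1) ^ 2 < y k := by
    -- The first two summands of `vecBound` are what `v i₀` could reach if all `y k` were small; the
    -- third bounds the entries of the vector constructed below.
    by_contra! hcon
    have h1 := combination_apply_le G y hκ hcon hGD i₀
    have h2 := hv₀ i₀
    have h3 : v i₀ = v₀ i₀ + (∑ k, y k • G k) i₀ := congrFun hvy i₀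
    simp only [vecBound] at hi₀
    omega
  obtain ⟨k₀, hk₀⟩ := hbig
  obtain ⟨h, hhz, hh0, hhD, hhs⟩ := exists_small_kernel_vector w (i₀ := some k₀) (by omega) hw
    hwz' (by
      rw [Fintype.card_option]
      refine lt_of_le_of_lt ?_ hk₀
      gcongr)
  have hhs' : ∑ k, (∑ i, ε i * G k i) * (h (some k) : ℤ) = h none := by
    rw [Fintype.sum_option] at hhs
    simp only [w, Option.elim_none, Option.elim_some] at hhs
    linarith
  refine ⟨∑ k, h (some k) • G k, ?_, ?_, ?_, ?_, ?_, ?_⟩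
  · rw [hvy]
    refine le_trans (sum_le_sum fun k _ => ?_) le_add_self
    exact fun i => Nat.mul_le_mul_right _ (hhz (some k))
  -- Nothing cancels in `ℕ` and every `G k` is non-zero, so all `h (some k)` vanish; then `h none`
  -- does too, by `hhs'`.
  · intro h0
    have hk : ∀ k, h (some k) = 0 := by
      intro k
      by_contra hne
      apply k.2.1
      funext i
      have h1 := congrFun h0 i
      simp only [Finset.sum_apply, Pi.smul_apply, smul_eq_mul, Pi.zero_apply,
        sum_eq_zero_iff, mem_univ, true_implies] at h1
      exact (mul_eq_zero.1 (h1 k)).resolve_left hne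
    apply hh0
    funext o
    rcases o with _ | k
    · simp only [hk, Nat.cast_zero, mul_zero, sum_const_zero] at hhs'
      exact_mod_cast hhs'.symm
    · exact hk k
  · intro i
    have := combination_apply_le G (fun k => h (some k)) hκ (fun k => hhD (some k)) hGD i
    simp only [vecBound]
    omega
  · rw [sum_mul_combination]
    exact sum_eq_zero fun k _ => by rw [k.2.2, zero_mul]
  · rw [sum_mul_combination, hhs']
    positivity
  · rw [sum_mul_combination, hhs', ← hslack]
    exact_mod_cast hhz none

/-- Solutions in `ℕ` of `s + β · v = t + γ · v ≤ r + α · v` are bounded vectors plus combinations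
of bounded solutions of `β · g = γ · g ≤ α · g`. -/
theorem exists_cone_decomposition {α β γ : ι → ℕ} {r s t D N : ℕ} (hD : 1 ≤ D)
    (hα : ∀ i, α i ≤ D) (hβ : ∀ i, β i ≤ D) (hγ : ∀ i, γ i ≤ D) (hr : r ≤ N) (hs : s ≤ N)
    (ht : t ≤ N) (G : κ → ι → ℕ)
    (hG : ∀ g : ι → ℕ, (∀ i, g i ≤ vecBound D N (Fintype.card ι)) →
      ∑ i, β i * g i = ∑ i, γ i * g i → ∑ i, β i * g i ≤ ∑ i, α i * g i → ∃ k, G k = g)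
    {v : ι → ℕ} (hv : s + ∑ i, β i * v i = t + ∑ i, γ i * v i)
    (hv' : s + ∑ i, β i * v i ≤ r + ∑ i, α i * v i) :
    ∃ (v₀ : ι → ℕ) (y : κ → ℕ), (∀ i, v₀ i ≤ vecBound D N (Fintype.card ι)) ∧
      (r = 0 → s = 0 → t = 0 → v₀ = 0) ∧ v = v₀ + ∑ k, y k • G k := by
  classical
  have hsum : ∀ (f g v : ι → ℕ), ∑ i, ((f i : ℤ) - g i) * v i
      = ((∑ i, f i * v i : ℕ) : ℤ) - (∑ i, g i * v i : ℕ) := by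
    intro f g v
    push_cast
    rw [← sum_sub_distrib]
    exact sum_congr rfl fun i _ => sub_mul _ _ _
  have hsub : ∀ f g v : ι → ℕ, g ≤ v →
      ∑ i, f i * (v - g) i + ∑ i, f i * g i = ∑ i, f i * v i := by
    intro f g v h
    rw [← sum_add_distrib]
    exact sum_congr rfl fun i _ => by
      rw [← mul_add, Pi.sub_apply, Nat.sub_add_cancel (h i)]
  obtain ⟨v₀, y, ⟨h1, h2⟩, hv₀, hvy⟩ := exists_bounded_add_combination G
    (fun v => s + ∑ i, β i * v i = t + ∑ i, γ i * v i ∧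
      s + ∑ i, β i * v i ≤ r + ∑ i, α i * v i) (vecBound D N (Fintype.card ι)) (by
      rintro v ⟨hv, hv'⟩ i hi
      -- `h1` and `h2` make `g` a homogeneous solution, hence some `G k`; `h3` says that the
      -- inequality survives subtraction of `g`.
      obtain ⟨g, hg, hg0, hgK, h1, h2, h3⟩ := exists_small_cone_vector
        (fun i => (β i : ℤ) - γ i) (fun i => (α i : ℤ) - β i) (d := (t : ℤ) - s)
        (e := (s : ℤ) - r) (N := N) hD
        (fun i => by have := hβ i; have := hγ i; rw [abs_le]; omega)
        (fun i => by have := hα i; have := hβ i; rw [abs_le]; omega)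
        (by rw [abs_le]; omega) (by rw [abs_le]; omega)
        (by rw [hsum]; omega) (by rw [hsum]; omega) hi
      rw [hsum] at h1 h2 h3
      rw [hsum] at h3
      obtain ⟨k, rfl⟩ := hG g hgK (by omega) (by omega)
      refine ⟨k, hg, hg0, ?_⟩
      have ha := hsub α _ _ hg
      have hb := hsub β _ _ hg
      have hc := hsub γ _ _ hg
      constructor <;> omega) v ⟨hv, hv'⟩
  -- In the homogeneous case the bounded remainder is itself one of the `G k` and is absorbed into
  -- the combination.
  by_cases h0 : r = 0 ∧ s = 0 ∧ t = 0
  · obtain ⟨rfl, rfl, rfl⟩ := h0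
    obtain ⟨k, hk⟩ := hG v₀ hv₀ (by omega) (by omega)
    refine ⟨0, y + Pi.single k 1, by simp, by simp, ?_⟩
    rw [combination_add_single, hk, zero_add, add_comm, ← hvy]
  · exact ⟨v₀, y, hv₀, fun a b c => absurd ⟨a, b, c⟩ h0, hvy⟩

end Decomposition

/-! ### From valuations at each prime to a global parametrization. -/

section Valuations

variable {ι κ κ' κ'' : Type*} [Fintype ι] [Fintype κ] [Fintype κ'] [Fintype κ'']

/-- The ultrametric inequality for `A = -(B + C)`. Applied to each of the three terms, it shows that
the least valuation occurs twice. -/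
theorem min_factorization_le {A B C : ℤ} (hA : A ≠ 0) (hB : B ≠ 0) (hC : C ≠ 0)
    (h : A + B + C = 0) {p : ℕ} (hp : p.Prime) :
    min (B.natAbs.factorization p) (C.natAbs.factorization p) ≤ A.natAbs.factorization p := by
  have key : ∀ {z : ℤ} {k : ℕ}, z ≠ 0 → (((p ^ k : ℕ) : ℤ) ∣ z ↔ k ≤ z.natAbs.factorization p) :=
    fun hz => by rw [Int.natCast_dvd, hp.pow_dvd_iff_le_factorization (Int.natAbs_ne_zero.2 hz)]
  rw [← key hA, show A = -(B + C) by linarith, dvd_neg]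
  exact dvd_add ((key hB).2 (min_le_left _ _)) ((key hC).2 (min_le_right _ _))

theorem term_ne_zero {c : ℤ} (hc : c ≠ 0) {x : ι → ℤ} (hx : ∀ i, x i ≠ 0) (α : ι → ℕ) :
    c * ∏ i, x i ^ α i ≠ 0 :=
  mul_ne_zero hc (prod_ne_zero_iff.2 fun i _ => pow_ne_zero _ (hx i))

theorem factorization_term {c : ℤ} (hc : c ≠ 0) {x : ι → ℤ} (hx : ∀ i, x i ≠ 0) (α : ι → ℕ)
    (p : ℕ) : (c * ∏ i, x i ^ α i).natAbs.factorization p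
      = c.natAbs.factorization p + ∑ i, α i * (x i).natAbs.factorization p := by
  have hprod : (∏ i, x i ^ α i).natAbs = ∏ i, (x i).natAbs ^ α i := by
    rw [← Int.natAbsHom_apply, map_prod]
    exact prod_congr rfl fun i _ => by rw [Int.natAbsHom_apply, Int.natAbs_pow]
  have h0 : ∀ i ∈ univ, (x i).natAbs ^ α i ≠ 0 :=
    fun i _ => pow_ne_zero _ (Int.natAbs_ne_zero.2 (hx i))
  rw [Int.natAbs_mul, hprod, Nat.factorization_mul (Int.natAbs_ne_zero.2 hc)
    (prod_ne_zero_iff.2 h0), Nat.factorization_prod h0, Finsupp.add_apply,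
    Finsupp.finsetSum_apply]
  simp [Nat.factorization_pow]

theorem prod_pow_factorization_eq {m : ℕ} (hm : m ≠ 0) {S : Finset ℕ} (hS : m.primeFactors ⊆ S) :
    ∏ p ∈ S, p ^ m.factorization p = m := by
  conv_rhs => rw [← Nat.prod_factorization_pow_eq_self hm]
  exact (Finsupp.prod_of_support_subset _ (by simpa using hS) _ (by simp)).symm

/-- Global factorization from decompositions of the vectors of valuations at all primes. -/
theorem exists_parametrization {x : ι → ℤ} (hx : ∀ i, x i ≠ 0) {M : ℕ} (hM : M ≠ 0) (K : ℕ)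
    (G : κ → ι → ℕ) (R : κ → κ → Prop)
    (h : ∀ p : ℕ, p.Prime → ∃ (v₀ : ι → ℕ) (y : κ → ℕ), (∀ i, v₀ i ≤ K) ∧
      (¬ p ∣ M → v₀ = 0) ∧ (∀ k k', R k k' → y k = 0 ∨ y k' = 0) ∧
      (fun i => (x i).natAbs.factorization p) = v₀ + ∑ k, y k • G k) :
    ∃ (t : ι → ℤ) (u : κ → ℤ), (∀ i, (t i).natAbs ≤ M ^ K) ∧ (∀ i, t i ≠ 0) ∧
      (∀ k, u k ≠ 0) ∧ (∀ k k', R k k' → Int.gcd (u k) (u k') = 1) ∧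
      ∀ i, x i = t i * ∏ k, u k ^ G k i := by
  classical
  choose! v₀ y hK hdvd hR hvy using h
  let S : Finset ℕ := M.primeFactors ∪ univ.biUnion fun i => (x i).natAbs.primeFactors
  have hS : ∀ p ∈ S, p.Prime := by
    intro p hp
    rcases mem_union.1 hp with hp | hp
    · exact Nat.prime_of_mem_primeFactors hp
    · obtain ⟨i, -, hi⟩ := mem_biUnion.1 hp
      exact Nat.prime_of_mem_primeFactors hi
  -- Only primes dividing `M` contribute, and their product divides `M`.
  have hbound : ∀ i, ∏ p ∈ S, p ^ v₀ p i ≤ M ^ K := by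
    intro i
    have h1 : ∏ p ∈ M.primeFactors, p ^ v₀ p i = ∏ p ∈ S, p ^ v₀ p i := by
      refine prod_subset subset_union_left fun p hp hpM => ?_
      rw [hdvd p (hS p hp) fun hd => hpM (Nat.mem_primeFactors.2 ⟨hS p hp, hd, hM⟩)]
      simp
    rw [← h1]
    calc ∏ p ∈ M.primeFactors, p ^ v₀ p i ≤ ∏ p ∈ M.primeFactors, p ^ K :=
          prod_le_prod' fun p hp => Nat.pow_le_pow_right
            (Nat.prime_of_mem_primeFactors hp).pos (hK p (Nat.prime_of_mem_primeFactors hp) i)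
      _ = (∏ p ∈ M.primeFactors, p) ^ K := prod_pow _ _ _
      _ ≤ M ^ K := Nat.pow_le_pow_left
          (Nat.le_of_dvd (Nat.pos_of_ne_zero hM) (Nat.prod_primeFactors_dvd M)) K
  have hne : ∀ f : ℕ → ℕ, ∏ p ∈ S, p ^ f p ≠ 0 := fun f =>
    prod_ne_zero_iff.2 fun p hp => pow_ne_zero _ (hS p hp).ne_zero
  -- The bounded parts and the signs go into `t`, and the multiplicities of the generator `k` at all
  -- primes into `u k`. Parameters related by `R` share no prime.
  refine ⟨fun i => (x i).sign * (∏ p ∈ S, p ^ v₀ p i : ℕ), fun k => (∏ p ∈ S, p ^ y p k : ℕ),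
    ?_, ?_, ?_, ?_, ?_⟩
  · intro i
    rw [Int.natAbs_mul, Int.natAbs_natCast, Int.natAbs_sign_of_ne_zero (hx i), one_mul]
    exact hbound i
  · exact fun i => mul_ne_zero (by simpa using hx i) (by exact_mod_cast hne _)
  · exact fun k => Int.natCast_ne_zero.2 (hne _)
  · intro k k' hkk
    rw [Int.gcd_natCast_natCast]
    refine Nat.Coprime.prod_left fun p hp => Nat.Coprime.prod_right fun q hq => ?_
    rcases eq_or_ne p q with rfl | hpq
    · rcases hR p (hS p hp) k k' hkk with h0 | h0 <;> simp [h0]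
    · exact Nat.Coprime.pow _ _ ((Nat.coprime_primes (hS p hp) (hS q hq)).2 hpq)
  · intro i
    have h1 : ∏ p ∈ S, p ^ (x i).natAbs.factorization p
        = (∏ p ∈ S, p ^ v₀ p i) * ∏ k, (∏ p ∈ S, p ^ y p k) ^ G k i := by
      simp only [← prod_pow]
      rw [prod_comm, ← prod_mul_distrib]
      refine prod_congr rfl fun p hp => ?_
      have h2 := congrFun (hvy p (hS p hp)) i
      simp only [Pi.add_apply, Finset.sum_apply, Pi.smul_apply, smul_eq_mul] at h2
      rw [h2, pow_add, ← prod_pow_eq_pow_sum]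
      simp only [pow_mul]
    rw [prod_pow_factorization_eq (Int.natAbs_ne_zero.2 (hx i))
      ((subset_biUnion_of_mem (fun i => (x i).natAbs.primeFactors) (mem_univ i)).trans
        subset_union_right)] at h1
    conv_lhs => rw [← Int.sign_mul_natAbs (x i), h1]
    push_cast
    ring

/-- `G` runs through all vectors `g` with entries at most `K` and `β · g = γ · g ≤ α · g`. -/
def Exhausts (G : κ → ι → ℕ) (K : ℕ) (α β γ : ι → ℕ) : Prop :=
  ∀ g : ι → ℕ, (∀ i, g i ≤ K) → ∑ i, β i * g i = ∑ i, γ i * g i →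
    ∑ i, β i * g i ≤ ∑ i, α i * g i → ∃ k, G k = g

theorem factorization_le_self (m p : ℕ) : m.factorization p ≤ m := by
  rcases eq_or_ne m 0 with rfl | hm
  · simp
  · exact (Nat.factorization_lt p hm).le

/-- Parametrization of the non-zero solutions of a two-monomial equation. -/
theorem exists_two_term_parametrization {a b : ℤ} (ha : a ≠ 0) (hb : b ≠ 0) {M D : ℕ}
    (hM : M ≠ 0) (haM : a.natAbs ∣ M) (hbM : b.natAbs ∣ M) (hD : 1 ≤ D) {α β : ι → ℕ}
    (hα : ∀ i, α i ≤ D) (hβ : ∀ i, β i ≤ D) {x : ι → ℤ} (hx : ∀ i, x i ≠ 0)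
    (h : a * ∏ i, x i ^ α i + b * ∏ i, x i ^ β i = 0) {G : κ → ι → ℕ}
    (hG : Exhausts G (vecBound D M (Fintype.card ι)) α α β) :
    ∃ (t : ι → ℤ) (u : κ → ℤ),
      (∀ i, (t i).natAbs ≤ M ^ vecBound D M (Fintype.card ι)) ∧ (∀ i, t i ≠ 0) ∧
      (∀ k, u k ≠ 0) ∧ ∀ i, x i = t i * ∏ k, u k ^ G k i := by
  -- `M` has two roles: its prime divisors contain all exceptional primes, and its size bounds the
  -- valuations of the coefficients.
  have hle : ∀ {m : ℕ} (p), m ∣ M → m.factorization p ≤ M := fun p hm =>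
    (factorization_le_self _ p).trans (Nat.le_of_dvd (Nat.pos_of_ne_zero hM) hm)
  have hz : ∀ {m p : ℕ}, m ∣ M → ¬ p ∣ M → m.factorization p = 0 := fun hm hp =>
    Nat.factorization_eq_zero_of_not_dvd fun hd => hp (hd.trans hm)
  obtain ⟨t, u, h1, h2, h3, -, h4⟩ := exists_parametrization hx hM
    (vecBound D M (Fintype.card ι)) G (fun _ _ => False) (by
      intro p hp
      have hf : (a * ∏ i, x i ^ α i).natAbs.factorization p
          = (b * ∏ i, x i ^ β i).natAbs.factorization p := by
        rw [eq_neg_of_add_eq_zero_left h, Int.natAbs_neg]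
      rw [factorization_term ha hx, factorization_term hb hx] at hf
      -- With `α` in the first two places the inequality is trivial and only the equality of
      -- valuations remains.
      obtain ⟨v₀, y, e1, e2, e3⟩ := exists_cone_decomposition hD hα hα hβ (hle p haM)
        (hle p haM) (hle p hbM) G hG hf le_rfl
      exact ⟨v₀, y, e1, fun hd => e2 (hz haM hd) (hz haM hd) (hz hbM hd),
        fun _ _ hf => hf.elim, e3⟩)
  exact ⟨t, u, h1, h2, h3, h4⟩

/-- Parametrization of the non-zero solutions of a three-monomial equation by parameters in three
coprime groups. -/
theorem exists_three_term_parametrization {a b c : ℤ} (ha : a ≠ 0) (hb : b ≠ 0) (hc : c ≠ 0)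
    {M D : ℕ} (hM : M ≠ 0) (haM : a.natAbs ∣ M) (hbM : b.natAbs ∣ M) (hcM : c.natAbs ∣ M)
    (hD : 1 ≤ D) {α β γ : ι → ℕ} (hα : ∀ i, α i ≤ D) (hβ : ∀ i, β i ≤ D) (hγ : ∀ i, γ i ≤ D)
    {x : ι → ℤ} (hx : ∀ i, x i ≠ 0)
    (h : a * ∏ i, x i ^ α i + b * ∏ i, x i ^ β i + c * ∏ i, x i ^ γ i = 0)
    {G : κ → ι → ℕ} {H : κ' → ι → ℕ} {L : κ'' → ι → ℕ}
    (hG : Exhausts G (vecBound D M (Fintype.card ι)) α β γ)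
    (hH : Exhausts H (vecBound D M (Fintype.card ι)) β α γ)
    (hL : Exhausts L (vecBound D M (Fintype.card ι)) γ α β) :
    ∃ (t : ι → ℤ) (u : κ → ℤ) (v : κ' → ℤ) (w : κ'' → ℤ),
      (∀ i, (t i).natAbs ≤ M ^ vecBound D M (Fintype.card ι)) ∧ (∀ i, t i ≠ 0) ∧
      (∀ k, u k ≠ 0) ∧ (∀ k, v k ≠ 0) ∧ (∀ k, w k ≠ 0) ∧
      (∀ i j, Int.gcd (u i) (v j) = 1) ∧ (∀ i j, Int.gcd (u i) (w j) = 1) ∧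
      (∀ i j, Int.gcd (v i) (w j) = 1) ∧
      ∀ i, x i = t i * (∏ k, u k ^ G k i) * (∏ k, v k ^ H k i) * ∏ k, w k ^ L k i := by
  have hle : ∀ {m : ℕ} (p), m ∣ M → m.factorization p ≤ M := fun p hm =>
    (factorization_le_self _ p).trans (Nat.le_of_dvd (Nat.pos_of_ne_zero hM) hm)
  have hz : ∀ {m p : ℕ}, m ∣ M → ¬ p ∣ M → m.factorization p = 0 := fun hm hp =>
    Nat.factorization_eq_zero_of_not_dvd fun hd => hp (hd.trans hm)
  let group : κ ⊕ κ' ⊕ κ'' → ℕ := Sum.elim (fun _ => 0) (Sum.elim (fun _ => 1) fun _ => 2)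
  obtain ⟨t, u, h1, h2, h3, h4, h5⟩ := exists_parametrization hx hM
    (vecBound D M (Fintype.card ι)) (Sum.elim G (Sum.elim H L))
    (fun k k' => group k ≠ group k') (by
      intro p hp
      have hA := term_ne_zero ha hx α
      have hB := term_ne_zero hb hx β
      have hC := term_ne_zero hc hx γ
      have hmA := min_factorization_le hA hB hC h hp
      have hmB := min_factorization_le hB hA hC (by linarith) hp
      have hmC := min_factorization_le hC hA hB (by linarith) hp
      rw [factorization_term ha hx, factorization_term hb hx, factorization_term hc hx]
        at hmA hmB hmC
      set fa := a.natAbs.factorization p + ∑ i, α i * (x i).natAbs.factorization p with hfa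
      set fb := b.natAbs.factorization p + ∑ i, β i * (x i).natAbs.factorization p with hfb
      set fc := c.natAbs.factorization p + ∑ i, γ i * (x i).natAbs.factorization p with hfc
      -- In each case the multiplicities at `p` are `0` outside one group, which yields coprimality
      -- between groups.
      have hcases : (fb = fc ∧ fb ≤ fa) ∨ (fa = fc ∧ fa ≤ fb) ∨ (fa = fb ∧ fa ≤ fc) := by
        omega
      rcases hcases with ⟨e, l⟩ | ⟨e, l⟩ | ⟨e, l⟩
      · obtain ⟨v₀, y, e1, e2, e3⟩ := exists_cone_decomposition hD hα hβ hγ (hle p haM)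
          (hle p hbM) (hle p hcM) G hG e l
        refine ⟨v₀, Sum.elim y 0, e1, fun hd => e2 (hz haM hd) (hz hbM hd) (hz hcM hd), ?_, ?_⟩
        · rintro (k | k | k) (k' | k' | k') <;> simp [group]
        · simpa using e3
      · obtain ⟨v₀, y, e1, e2, e3⟩ := exists_cone_decomposition hD hβ hα hγ (hle p hbM)
          (hle p haM) (hle p hcM) H hH e l
        refine ⟨v₀, Sum.elim 0 (Sum.elim y 0), e1,
          fun hd => e2 (hz hbM hd) (hz haM hd) (hz hcM hd), ?_, ?_⟩
        · rintro (k | k | k) (k' | k' | k') <;> simp [group]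
        · simpa using e3
      · obtain ⟨v₀, y, e1, e2, e3⟩ := exists_cone_decomposition hD hγ hα hβ (hle p hcM)
          (hle p haM) (hle p hbM) L hL e l
        refine ⟨v₀, Sum.elim 0 (Sum.elim 0 y), e1,
          fun hd => e2 (hz hcM hd) (hz haM hd) (hz hbM hd), ?_, ?_⟩
        · rintro (k | k | k) (k' | k' | k') <;> simp [group]
        · simpa using e3)
  refine ⟨t, fun k => u (.inl k), fun k => u (.inr (.inl k)), fun k => u (.inr (.inr k)), h1, h2,
    fun k => h3 _, fun k => h3 _, fun k => h3 _, fun i j => h4 _ _ (by simp [group]),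
    fun i j => h4 _ _ (by simp [group]), fun i j => h4 _ _ (by simp [group]), fun i => ?_⟩
  rw [h5 i, Fintype.prod_sum_type, Fintype.prod_sum_type]
  simp only [Sum.elim_inl, Sum.elim_inr, mul_assoc]

end Valuations

/-! ### Effect of monomial substitutions on the terms. -/

section MonomialIdentities

variable {ι κ κ' κ'' : Type*} [Fintype ι] [Fintype κ] [Fintype κ'] [Fintype κ'']

theorem prod_combination_pow (u : κ → ℤ) (G : κ → ι → ℕ) (α : ι → ℕ) :
    ∏ i, (∏ k, u k ^ G k i) ^ α i = ∏ k, u k ^ ∑ i, α i * G k i := by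
  simp only [← prod_pow]
  rw [prod_comm]
  refine prod_congr rfl fun k _ => ?_
  rw [← prod_pow_eq_pow_sum]
  exact prod_congr rfl fun i _ => by rw [← pow_mul, mul_comm]

theorem prod_pow_split (u : κ → ℤ) {e f : κ → ℕ} (h : ∀ k, f k ≤ e k) :
    ∏ k, u k ^ e k = (∏ k, u k ^ f k) * ∏ k, u k ^ (e k - f k) := by
  rw [← prod_mul_distrib]
  exact prod_congr rfl fun k _ => by rw [← pow_add, Nat.add_sub_cancel' (h k)]

theorem subst_two_terms (a b : ℤ) {t x : ι → ℤ} {u : κ → ℤ} {G : κ → ι → ℕ} {α β : ι → ℕ}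
    (hG : ∀ k, ∑ i, α i * G k i = ∑ i, β i * G k i) (hx : ∀ i, x i = t i * ∏ k, u k ^ G k i) :
    a * ∏ i, x i ^ α i + b * ∏ i, x i ^ β i
      = (∏ k, u k ^ ∑ i, α i * G k i) * (a * ∏ i, t i ^ α i + b * ∏ i, t i ^ β i) := by
  simp only [hx, mul_pow, prod_mul_distrib, prod_combination_pow, ← hG]
  ring

/-- A generator in `G` has equal exponents in the second and third terms and at least as large a one
in the first. The smaller power factors out of all three, and the excess stays in the first term;
`H` and `L` behave alike. -/
theorem subst_three_terms (a b c : ℤ) {t x : ι → ℤ} {u : κ → ℤ} {v : κ' → ℤ} {w : κ'' → ℤ}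
    {G : κ → ι → ℕ} {H : κ' → ι → ℕ} {L : κ'' → ι → ℕ} {α β γ : ι → ℕ}
    (hG : ∀ k, ∑ i, β i * G k i = ∑ i, γ i * G k i ∧ ∑ i, β i * G k i ≤ ∑ i, α i * G k i)
    (hH : ∀ k, ∑ i, α i * H k i = ∑ i, γ i * H k i ∧ ∑ i, α i * H k i ≤ ∑ i, β i * H k i)
    (hL : ∀ k, ∑ i, α i * L k i = ∑ i, β i * L k i ∧ ∑ i, α i * L k i ≤ ∑ i, γ i * L k i)
    (hx : ∀ i, x i = t i * (∏ k, u k ^ G k i) * (∏ k, v k ^ H k i) * ∏ k, w k ^ L k i) :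
    a * ∏ i, x i ^ α i + b * ∏ i, x i ^ β i + c * ∏ i, x i ^ γ i
      = ((∏ k, u k ^ ∑ i, β i * G k i) * (∏ k, v k ^ ∑ i, α i * H k i) *
          ∏ k, w k ^ ∑ i, α i * L k i) *
        ((a * ∏ i, t i ^ α i) * (∏ k, u k ^ (∑ i, α i * G k i - ∑ i, β i * G k i)) +
          (b * ∏ i, t i ^ β i) * (∏ k, v k ^ (∑ i, β i * H k i - ∑ i, α i * H k i)) +
          (c * ∏ i, t i ^ γ i) * ∏ k, w k ^ (∑ i, γ i * L k i - ∑ i, α i * L k i)) := by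
  simp only [hx, mul_pow, prod_mul_distrib, prod_combination_pow, ← (hG _).1, ← (hH _).1,
    ← (hL _).1]
  rw [prod_pow_split u fun k => (hG k).2, prod_pow_split v fun k => (hH k).2,
    prod_pow_split w fun k => (hL k).2]
  ring

theorem term_eq_zero_iff {c : ℤ} (hc : c ≠ 0) (x : ι → ℤ) (α : ι → ℕ) :
    c * ∏ i, x i ^ α i = 0 ↔ ∃ i, x i = 0 ∧ α i ≠ 0 := by
  simp [hc, prod_eq_zero_iff]

/-- This lets the algorithm, which sees only `t`, select the branch that fits the vanishing terms of
`x`. -/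
theorem term_eq_zero_congr {c : ℤ} (hc : c ≠ 0) {x t : ι → ℤ} (h : ∀ i, x i = 0 ↔ t i = 0)
    (α : ι → ℕ) : c * ∏ i, x i ^ α i = 0 ↔ c * ∏ i, t i ^ α i = 0 := by
  simp only [term_eq_zero_iff hc, h]

/-- Zero entries may be replaced by `1` in a non-zero monomial. -/
theorem term_replace_zero {c : ℤ} {x : ι → ℤ} {α : ι → ℕ} (h : c * ∏ i, x i ^ α i ≠ 0) :
    c * ∏ i, (if x i = 0 then 1 else x i) ^ α i = c * ∏ i, x i ^ α i := by
  have hc : c ≠ 0 := left_ne_zero_of_mul h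
  rw [Ne, term_eq_zero_iff hc] at h
  push Not at h
  congr 1
  refine prod_congr rfl fun i _ => ?_
  split_ifs with hi
  · simp [h i hi]
  · rfl

end MonomialIdentities

/-! ### Translation between lists and vectors. -/

/-- The vector of the first `n` entries of a list. -/
def vec (n : ℕ) (l : List ℕ) : Fin n → ℕ := fun i => l.getD i 0

/-- The vectors given by the first `m` entries of a list of lists. -/
def vecs (m n : ℕ) (G : List (List ℕ)) : Fin m → Fin n → ℕ := fun k => vec n (G.getD k [])

theorem vec_ofFn {n : ℕ} (g : Fin n → ℕ) : vec n (List.ofFn g) = g := by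
  funext i
  simp [vec, List.getD_eq_getElem?_getD]

theorem dot_eq (n : ℕ) (l m : List ℕ) : dot n l m = ∑ i, vec n l i * vec n m i := by
  simp only [vec]
  rw [← Finset.sum_range fun i => l.getD i 0 * m.getD i 0]
  rfl

theorem termValue_eq (n : ℕ) (c : ℤ) (t : List ℤ) (l : List ℕ) :
    termValue n c t l = c * ∏ i : Fin n, t.getD i 0 ^ vec n l i := by
  simp only [vec]
  rw [← Finset.prod_range fun i => t.getD i 0 ^ l.getD i 0]
  rfl

theorem ofFn_mem_box {K n : ℕ} {g : Fin n → ℕ} (hg : ∀ i, g i ≤ K) : List.ofFn g ∈ box K n := by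
  induction n with
  | zero => simp [box]
  | succ n ih =>
    rw [List.ofFn_succ]
    refine List.mem_flatMap.2 ⟨_, ih fun i => hg i.succ, List.mem_map.2 ⟨g 0, ?_, rfl⟩⟩
    exact List.mem_range.2 (Nat.lt_succ_of_le (hg 0))

/-- The code of `z` is at most `2 * |z|`, whence the factor `2` in `reduce`. -/
theorem ofFn_mem_intBox {T n : ℕ} {t : Fin n → ℤ} (ht : ∀ i, 2 * (t i).natAbs ≤ T) :
    List.ofFn t ∈ intBox T n := by
  refine List.mem_map.2 ⟨List.ofFn fun i => Encodable.encode (t i), ofFn_mem_box fun i => ?_, ?_⟩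
  · have := ht i
    rw [encode_int]
    split_ifs <;> omega
  · rw [List.map_ofFn]
    congr 1
    funext i
    exact Denumerable.ofNat_encode (t i)

theorem mem_gens {K n : ℕ} {α β γ g : List ℕ} :
    g ∈ gens K n α β γ ↔ g ∈ box K n ∧ dot n β g = dot n γ g ∧ dot n β g ≤ dot n α g := by
  rw [gens, List.mem_flatMap]
  constructor
  · rintro ⟨h, hh, hg⟩
    split_ifs at hg with hc
    · rw [List.mem_singleton.1 hg]
      exact ⟨hh, hc⟩
    · simp at hg
  · rintro ⟨hb, hc⟩
    exact ⟨g, hb, by rw [if_pos hc]; exact List.mem_singleton_self g⟩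

/-- The index bound `m` is kept apart from the length of the list because it will be the length of
`gapExps`, which is equal but not by definition; this avoids casts between `Fin` types. -/
theorem vecs_gens {K n m : ℕ} {α β γ : List ℕ} (hm : m ≤ (gens K n α β γ).length) (k : Fin m) :
    ∑ i, vec n β i * vecs m n (gens K n α β γ) k i =
      ∑ i, vec n γ i * vecs m n (gens K n α β γ) k i ∧
    ∑ i, vec n β i * vecs m n (gens K n α β γ) k i ≤
      ∑ i, vec n α i * vecs m n (gens K n α β γ) k i := by
  have hk := k.2.trans_le hm
  simp only [vecs, ← dot_eq]
  rw [List.getD_eq_getElem _ _ hk]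
  exact (mem_gens.1 (List.getElem_mem hk)).2

theorem exhausts_gens {K n m : ℕ} {α β γ : List ℕ} (hm : (gens K n α β γ).length ≤ m) :
    Exhausts (vecs m n (gens K n α β γ)) K (vec n α) (vec n β) (vec n γ) := by
  intro g hg h1 h2
  have hmem : List.ofFn g ∈ gens K n α β γ := by
    refine mem_gens.2 ⟨ofFn_mem_box hg, ?_, ?_⟩ <;> simpa only [dot_eq, vec_ofFn]
  obtain ⟨k, hk, hkg⟩ := List.getElem_of_mem hmem
  refine ⟨⟨k, hk.trans_le hm⟩, ?_⟩
  change vec n ((gens K n α β γ).getD k []) = g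
  rw [List.getD_eq_getElem _ _ hk, hkg, vec_ofFn]

theorem length_gapExps (n : ℕ) (α β : List ℕ) (G : List (List ℕ)) :
    (gapExps n α β G).length = G.length := List.length_map _

theorem get_gapExps {n : ℕ} {α β : List ℕ} {G : List (List ℕ)}
    (k : Fin (gapExps n α β G).length) :
    (gapExps n α β G).get k = ∑ i, vec n α i * vecs (gapExps n α β G).length n G k i -
      ∑ i, vec n β i * vecs (gapExps n α β G).length n G k i := by
  have hk : (k : ℕ) < G.length := (length_gapExps n α β G) ▸ k.2
  simp only [vecs, ← dot_eq]
  rw [List.getD_eq_getElem _ _ hk]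
  exact List.getElem_map _

theorem monomialValue_map {m n : ℕ} (G : List (List ℕ)) (v : Fin m → ℤ) (i : Fin n) :
    monomialValue (G.map fun g => g.getD i 0) v = ∏ k, v k ^ vecs m n G k i := by
  refine prod_congr rfl fun k _ => ?_
  congr 1
  exact List.getD_map G [] (n := k) fun g : List ℕ => g.getD i 0

theorem recover_substList {n : ℕ} {I : IndepEquation} {t : List ℤ} {G H L : List (List ℕ)}
    (s : I.Point) (i : Fin n) :
    Branch.recover ⟨I, substList n t G H L⟩ n s i = t.getD i 0 *
      (∏ k, s.1 k ^ vecs _ n G k i) * (∏ k, s.2.1 k ^ vecs _ n H k i) *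
        ∏ k, s.2.2 k ^ vecs _ n L k i := by
  have h : (substList n t G H L).getD i (0, [], [], []) = (t.getD i 0, G.map fun g => g.getD i 0,
      H.map fun g => g.getD i 0, L.map fun g => g.getD i 0) := by
    rw [List.getD_eq_getElem _ _ (by simp [substList])]
    simp [substList]
  simp only [Branch.recover]
  rw [h]
  simp only [monomialValue_map]

/-! ### Every branch produces solutions. -/

section Soundness

variable {K n : ℕ} {a b c p q r : ℤ} {t : List ℤ} {α β γ : List ℕ}

theorem recover_freeBranch (s : (freeBranch K n p q r t α β).eqn.Point) (i : Fin n) :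
    (freeBranch K n p q r t α β).recover n s i
      = t.getD i 0 * ∏ k, s.1 k ^ vecs _ n (gens K n α α β) k i := by
  have h2 : ∏ k, s.2.1 k ^ vecs _ n [] k i = 1 := Fintype.prod_empty (ι := Fin 0) _
  have h3 : ∏ k, s.2.2 k ^ vecs _ n [] k i = 1 := Fintype.prod_empty (ι := Fin 0) _
  have h : ∀ A B C : ℤ, B = 1 → C = 1 → A * B * C = A := by
    rintro A _ _ rfl rfl
    rw [mul_one, mul_one]
  exact (recover_substList (t := t) s i).trans (h _ _ _ h2 h3)

/-- All gap exponents are `α · g - α · g = 0`, so the parameters drop out of the equation. -/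
theorem mem_solutions_freeBranch {s : (freeBranch K n p q r t α β).eqn.Point} :
    s ∈ (freeBranch K n p q r t α β).eqn.solutions ↔ p + q + r = 0 := by
  have h1 : ∏ i, s.1 i ^ (gapExps n α α (gens K n α α β)).get i = 1 :=
    prod_eq_one fun k _ => by
      have hk := get_gapExps (n := n) (α := α) (β := α) (G := gens K n α α β) k
      rw [Nat.sub_self] at hk
      exact (congrArg (s.1 k ^ ·) hk).trans (pow_zero _)
  have h2 : ∏ i, s.2.1 i ^ ([] : List ℕ).get i = 1 := Fintype.prod_empty (ι := Fin 0) _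
  have h3 : ∏ i, s.2.2 i ^ ([] : List ℕ).get i = 1 := Fintype.prod_empty (ι := Fin 0) _
  have h : ∀ A B C : ℤ, A = 1 → B = 1 → C = 1 → (p * A + q * B + r * C = 0 ↔ p + q + r = 0) := by
    rintro _ _ _ rfl rfl rfl
    simp only [mul_one]
  exact h _ _ _ h1 h2 h3

theorem two_terms_recover_freeBranch (s : (freeBranch K n p q r t α β).eqn.Point) (a b : ℤ)
    (h : termValue n a t α + termValue n b t β = 0) :
    a * ∏ i, (freeBranch K n p q r t α β).recover n s i ^ vec n α i +
      b * ∏ i, (freeBranch K n p q r t α β).recover n s i ^ vec n β i = 0 := by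
  rw [subst_two_terms a b (fun k => (vecs_gens (length_gapExps n α α _).le k).1)
    (recover_freeBranch s), ← termValue_eq, ← termValue_eq, h, mul_zero]

theorem term_recover_freeBranch {l : List ℕ} (s : (freeBranch K n p q r t α β).eqn.Point)
    (hc : c ≠ 0) (h : termValue n c t l = 0) :
    c * ∏ i, (freeBranch K n p q r t α β).recover n s i ^ vec n l i = 0 := by
  rw [termValue_eq, term_eq_zero_iff hc] at h
  rw [term_eq_zero_iff hc]
  obtain ⟨i, hi, hl⟩ := h
  exact ⟨i, by rw [recover_freeBranch, hi, zero_mul], hl⟩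

/-- Soundness needs only the factorization; completeness cancels `F`, which requires non-zero
parameters. -/
theorem full_identity (s : (fullBranch K n p q r t α β γ).eqn.Point) (a b c : ℤ) :
    ∃ F : ℤ, ((∀ k, s.1 k ≠ 0) → (∀ k, s.2.1 k ≠ 0) → (∀ k, s.2.2 k ≠ 0) → F ≠ 0) ∧
    a * ∏ i, (fullBranch K n p q r t α β γ).recover n s i ^ vec n α i +
      b * ∏ i, (fullBranch K n p q r t α β γ).recover n s i ^ vec n β i +
      c * ∏ i, (fullBranch K n p q r t α β γ).recover n s i ^ vec n γ i =
    F * (termValue n a t α * ∏ i, s.1 i ^ (gapExps n α β (gens K n α β γ)).get i +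
      termValue n b t β * ∏ i, s.2.1 i ^ (gapExps n β α (gens K n β α γ)).get i +
      termValue n c t γ * ∏ i, s.2.2 i ^ (gapExps n γ α (gens K n γ α β)).get i) := by
  have h := subst_three_terms a b c
    (fun k => vecs_gens (length_gapExps n α β (gens K n α β γ)).le k)
    (fun k => vecs_gens (length_gapExps n β α (gens K n β α γ)).le k)
    (fun k => vecs_gens (length_gapExps n γ α (gens K n γ α β)).le k)
    (fun i => recover_substList (t := t) s i)
  simp only [← get_gapExps, ← termValue_eq] at h
  refine ⟨_, ?_, h⟩
  intro h1 h2 h3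
  exact mul_ne_zero (mul_ne_zero (prod_ne_zero_iff.2 fun k _ => pow_ne_zero _ (h1 k))
    (prod_ne_zero_iff.2 fun k _ => pow_ne_zero _ (h2 k)))
    (prod_ne_zero_iff.2 fun k _ => pow_ne_zero _ (h3 k))

/-- `x` solves the equation with coefficients `a`, `b`, `c` and exponent lists `α`, `β`, `γ`. -/
def IsSolution (n : ℕ) (a b c : ℤ) (α β γ : List ℕ) (x : Fin n → ℤ) : Prop :=
  a * ∏ i, x i ^ vec n α i + b * ∏ i, x i ^ vec n β i + c * ∏ i, x i ^ vec n γ i = 0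

theorem branchesAt_nondegenerate {B : Branch} (hB : B ∈ branchesAt K n p q r t α β γ) :
    B.eqn.Nondegenerate := by
  rw [branchesAt] at hB
  split_ifs at hB <;> simp only [List.mem_singleton, List.not_mem_nil] at hB <;> subst hB <;>
    simp [IndepEquation.Nondegenerate, freeBranch, fullBranch, *]

theorem recover_isSolution (ha : a ≠ 0) (hb : b ≠ 0) (hc : c ≠ 0) {B : Branch}
    (hB : B ∈ branchesAt K n (termValue n a t α) (termValue n b t β) (termValue n c t γ) t α β γ)
    {s : B.eqn.Point} (hs : s ∈ B.eqn.solutions) :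
    IsSolution n a b c α β γ (B.recover n s) := by
  rw [branchesAt] at hB
  unfold IsSolution
  split_ifs at hB with hp hq hr hr hq hr hr <;>
    simp only [List.mem_singleton, List.not_mem_nil] at hB <;> subst hB
  · rw [term_recover_freeBranch s ha hp, term_recover_freeBranch s hb hq,
      term_recover_freeBranch s hc hr]
    rfl
  · rw [mem_solutions_freeBranch] at hs
    rw [term_recover_freeBranch s ha hp, zero_add,
      two_terms_recover_freeBranch s b c (by linarith)]
  · rw [mem_solutions_freeBranch] at hs
    rw [term_recover_freeBranch s hb hq, add_zero,
      two_terms_recover_freeBranch s a c (by linarith)]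
  · rw [mem_solutions_freeBranch] at hs
    rw [term_recover_freeBranch s hc hr, add_zero,
      two_terms_recover_freeBranch s a b (by linarith)]
  · obtain ⟨F, -, hF⟩ := full_identity s a b c
    rw [hF]
    exact mul_eq_zero_of_right F hs

end Soundness

/-! ### Every solution comes from a primitive solution of some branch. -/

section Completeness

variable {K n : ℕ} {a b c p q r : ℤ} {α β γ : List ℕ} {x t : Fin n → ℤ}

theorem getD_ofFn (t : Fin n → ℤ) (i : Fin n) : (List.ofFn t).getD i 0 = t i := by
  simp [List.getD_eq_getElem?_getD]

theorem termValue_ofFn (c : ℤ) (t : Fin n → ℤ) (l : List ℕ) :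
    termValue n c (List.ofFn t) l = c * ∏ i, t i ^ vec n l i := by
  simp only [termValue_eq, getD_ofFn]

/-- The other two groups are empty, so primitivity is vacuous and no coprimality of the `u k` is
needed. -/
theorem exists_mem_freeBranch (hpqr : p + q + r = 0)
    {u : Fin (gapExps n α α (gens K n α α β)).length → ℤ}
    (hx : ∀ i, x i = t i * ∏ k, u k ^ vecs _ n (gens K n α α β) k i) :
    ∃ s ∈ (freeBranch K n p q r (List.ofFn t) α β).eqn.primitiveSolutions,
      (freeBranch K n p q r (List.ofFn t) α β).recover n s = x := by
  refine ⟨(u, fun k : Fin 0 => k.elim0, fun k : Fin 0 => k.elim0), ⟨mem_solutions_freeBranch.2 hpqr,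
    fun _ (k : Fin 0) => k.elim0, fun _ (k : Fin 0) => k.elim0, fun (k : Fin 0) => k.elim0⟩, ?_⟩
  funext i
  rw [recover_freeBranch, hx i, getD_ofFn]
  rfl

/-- Reinsertion of the zero entries of `x` into a parametrization. -/
theorem exists_zero_extension {T : ℕ} {t' P : Fin n → ℤ} (hT : ∀ i, (t' i).natAbs ≤ T)
    (ht' : ∀ i, t' i ≠ 0) (hx : ∀ i, (if x i = 0 then 1 else x i) = t' i * P i) :
    ∃ t : Fin n → ℤ, List.ofFn t ∈ intBox (2 * T) n ∧ (∀ i, x i = 0 ↔ t i = 0) ∧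
      ∀ i, x i = t i * P i := by
  refine ⟨fun i => if x i = 0 then 0 else t' i, ofFn_mem_intBox fun i => ?_, fun i => ?_,
    fun i => ?_⟩
  · have := hT i
    split_ifs
    · simp
    · omega
  · by_cases h : x i = 0 <;> simp [h, ht' i]
  · have := hx i
    by_cases h : x i = 0
    · simp [h]
    · simpa [h] using this

/-- Parametrization of a point whose non-zero entries satisfy a two-monomial equation. -/
theorem exists_free_parametrization (ha : a ≠ 0) (hb : b ≠ 0) {M D : ℕ} (hM : M ≠ 0)
    (haM : a.natAbs ∣ M) (hbM : b.natAbs ∣ M) (hD : 1 ≤ D) (hα : ∀ i, vec n α i ≤ D)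
    (hβ : ∀ i, vec n β i ≤ D)
    (h : a * ∏ i, (if x i = 0 then 1 else x i) ^ vec n α i +
      b * ∏ i, (if x i = 0 then 1 else x i) ^ vec n β i = 0) :
    ∃ t : Fin n → ℤ, List.ofFn t ∈ intBox (2 * M ^ vecBound D M n) n ∧
      (∀ i, x i = 0 ↔ t i = 0) ∧
      ∃ u : Fin (gapExps n α α (gens (vecBound D M n) n α α β)).length → ℤ, (∀ k, u k ≠ 0) ∧
        ∀ i, x i = t i * ∏ k, u k ^ vecs _ n (gens (vecBound D M n) n α α β) k i := by
  have hx' : ∀ i, (if x i = 0 then 1 else x i) ≠ 0 := fun i => by split_ifs with h <;> simp [h]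
  have hG := exhausts_gens (n := n) (K := vecBound D M n) (length_gapExps n α α
    (gens (vecBound D M n) n α α β)).ge
  obtain ⟨t', u, h1, h2, h3, h4⟩ := exists_two_term_parametrization ha hb hM haM hbM hD hα hβ hx' h
    (by rw [Fintype.card_fin]; exact hG)
  rw [Fintype.card_fin] at h1
  obtain ⟨t, e1, e2, e3⟩ := exists_zero_extension h1 h2 h4
  exact ⟨t, e1, e2, u, h3, e3⟩

/-- The valuation argument uses `h`, where no entry is zero; `hsol`, about `x` itself, gives the
reduced equation after the common factor is cancelled. -/
theorem exists_full_parametrization (ha : a ≠ 0) (hb : b ≠ 0) (hc : c ≠ 0) {M D : ℕ} (hM : M ≠ 0)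
    (haM : a.natAbs ∣ M) (hbM : b.natAbs ∣ M) (hcM : c.natAbs ∣ M) (hD : 1 ≤ D)
    (hα : ∀ i, vec n α i ≤ D) (hβ : ∀ i, vec n β i ≤ D) (hγ : ∀ i, vec n γ i ≤ D)
    (h : a * ∏ i, (if x i = 0 then 1 else x i) ^ vec n α i +
      b * ∏ i, (if x i = 0 then 1 else x i) ^ vec n β i +
      c * ∏ i, (if x i = 0 then 1 else x i) ^ vec n γ i = 0)
    (hsol : IsSolution n a b c α β γ x) :
    ∃ t : Fin n → ℤ, List.ofFn t ∈ intBox (2 * M ^ vecBound D M n) n ∧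
      (∀ i, x i = 0 ↔ t i = 0) ∧
      ∃ s ∈ (fullBranch (vecBound D M n) n (termValue n a (List.ofFn t) α)
        (termValue n b (List.ofFn t) β) (termValue n c (List.ofFn t) γ) (List.ofFn t)
        α β γ).eqn.primitiveSolutions,
        (fullBranch (vecBound D M n) n (termValue n a (List.ofFn t) α)
        (termValue n b (List.ofFn t) β) (termValue n c (List.ofFn t) γ) (List.ofFn t)
        α β γ).recover n s = x := by
  have hx' : ∀ i, (if x i = 0 then 1 else x i) ≠ 0 := fun i => by split_ifs with h <;> simp [h]
  obtain ⟨t', u, v, w, h1, h2, hu, hv, hw, huv, huw, hvw, h4⟩ :=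
    exists_three_term_parametrization ha hb hc hM haM hbM hcM hD hα hβ hγ hx' h
    (by rw [Fintype.card_fin]; exact exhausts_gens (length_gapExps n α β _).ge)
    (by rw [Fintype.card_fin]; exact exhausts_gens (length_gapExps n β α _).ge)
    (by rw [Fintype.card_fin]; exact exhausts_gens (length_gapExps n γ α _).ge)
  rw [Fintype.card_fin] at h1
  obtain ⟨t, e1, e2, e3⟩ := exists_zero_extension h1 h2 fun i =>
    (h4 i).trans (by rw [mul_assoc, mul_assoc])
  refine ⟨t, e1, e2, (u, v, w), ⟨?_, huv, huw, hvw⟩, ?_⟩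
  all_goals
    have hrec : (fullBranch (vecBound D M n) n (termValue n a (List.ofFn t) α)
        (termValue n b (List.ofFn t) β) (termValue n c (List.ofFn t) γ) (List.ofFn t)
        α β γ).recover n (u, v, w) = x := by
      funext i
      refine (recover_substList (t := List.ofFn t) _ i).trans ?_
      rw [e3 i, getD_ofFn, mul_assoc, mul_assoc]
  · obtain ⟨F, hF0, hF⟩ := full_identity (K := vecBound D M n) (n := n)
      (p := termValue n a (List.ofFn t) α) (q := termValue n b (List.ofFn t) β)
      (r := termValue n c (List.ofFn t) γ) (t := List.ofFn t) (α := α) (β := β) (γ := γ)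
      (u, v, w) a b c
    rw [hrec] at hF
    exact (mul_eq_zero.1 (hF.symm.trans hsol)).resolve_left (hF0 hu hv hw)
  · exact hrec

theorem exists_branch_of_isSolution (ha : a ≠ 0) (hb : b ≠ 0) (hc : c ≠ 0) {M D : ℕ} (hM : M ≠ 0)
    (haM : a.natAbs ∣ M) (hbM : b.natAbs ∣ M) (hcM : c.natAbs ∣ M) (hD : 1 ≤ D)
    (hα : ∀ i, vec n α i ≤ D) (hβ : ∀ i, vec n β i ≤ D) (hγ : ∀ i, vec n γ i ≤ D)
    (hsol : IsSolution n a b c α β γ x) :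
    ∃ t ∈ intBox (2 * M ^ vecBound D M n) n,
      ∃ B ∈ branchesAt (vecBound D M n) n (termValue n a t α) (termValue n b t β)
        (termValue n c t γ) t α β γ, ∃ s ∈ B.eqn.primitiveSolutions, B.recover n s = x := by
  have hz : ∀ {t : Fin n → ℤ}, (∀ i, x i = 0 ↔ t i = 0) → ∀ {c : ℤ}, c ≠ 0 → ∀ l : List ℕ,
      (c * ∏ i, x i ^ vec n l i = 0 ↔ termValue n c (List.ofFn t) l = 0) := fun h _ hc l => by
    rw [termValue_ofFn]
    exact term_eq_zero_congr hc h _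
  have hsum := hsol
  rw [IsSolution] at hsum
  by_cases hA : a * ∏ i, x i ^ vec n α i = 0 <;> by_cases hB : b * ∏ i, x i ^ vec n β i = 0 <;>
    by_cases hC : c * ∏ i, x i ^ vec n γ i = 0
  -- All terms vanish, so the non-zero entries are unconstrained; the tautology `X - X = 0` serves
  -- as the two-monomial equation.
  · obtain ⟨t, ht, ht0, u, -, hx⟩ := exists_free_parametrization (x := x) (one_ne_zero (α := ℤ))
      (neg_ne_zero.2 (one_ne_zero (α := ℤ))) hM (by simp) (by simp) hD hα hα (by ring)
    refine ⟨_, ht, _, ?_, exists_mem_freeBranch (p := 1) (q := 1) (r := -2) (by norm_num) hx⟩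
    simp [branchesAt, (hz ht0 ha α).1 hA, (hz ht0 hb β).1 hB, (hz ht0 hc γ).1 hC]
  -- A single non-zero term cannot occur.
  · exact absurd (by linarith) hC
  · exact absurd (by linarith) hB
  · obtain ⟨t, ht, ht0, u, hu, hx⟩ := exists_free_parametrization (x := x) hb hc hM hbM hcM hD hβ hγ
      (by rw [term_replace_zero hB, term_replace_zero hC]; linarith)
    refine ⟨_, ht, _, ?_, exists_mem_freeBranch (p := 2 * termValue n b (List.ofFn t) β)
      (q := termValue n c (List.ofFn t) γ) (r := -1 * termValue n b (List.ofFn t) β) ?_ hx⟩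
    · simp [branchesAt, (hz ht0 ha α).1 hA, mt (hz ht0 hb β).2 hB, mt (hz ht0 hc γ).2 hC]
    -- The power of the parameters that factors out is non-zero, so the two surviving terms already
    -- cancel at `t`.
    · have h := subst_two_terms b c
        (fun k => (vecs_gens (length_gapExps n β β _).le k).1) hx
      have h0 := (mul_eq_zero.1 (h.symm.trans (by linarith))).resolve_left
        (prod_ne_zero_iff.2 fun k _ => pow_ne_zero _ (hu k))
      rw [termValue_ofFn, termValue_ofFn]
      linarith
  · exact absurd (by linarith) hA
  · obtain ⟨t, ht, ht0, u, hu, hx⟩ := exists_free_parametrization (x := x) ha hc hM haM hcM hD hα hγ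
      (by rw [term_replace_zero hA, term_replace_zero hC]; linarith)
    refine ⟨_, ht, _, ?_, exists_mem_freeBranch (p := 2 * termValue n a (List.ofFn t) α)
      (q := termValue n c (List.ofFn t) γ) (r := -1 * termValue n a (List.ofFn t) α) ?_ hx⟩
    · simp [branchesAt, mt (hz ht0 ha α).2 hA, (hz ht0 hb β).1 hB, mt (hz ht0 hc γ).2 hC]
    · have h := subst_two_terms a c
        (fun k => (vecs_gens (length_gapExps n α α _).le k).1) hx
      have h0 := (mul_eq_zero.1 (h.symm.trans (by linarith))).resolve_left
        (prod_ne_zero_iff.2 fun k _ => pow_ne_zero _ (hu k))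
      rw [termValue_ofFn, termValue_ofFn]
      linarith
  · obtain ⟨t, ht, ht0, u, hu, hx⟩ := exists_free_parametrization (x := x) ha hb hM haM hbM hD hα hβ
      (by rw [term_replace_zero hA, term_replace_zero hB]; linarith)
    refine ⟨_, ht, _, ?_, exists_mem_freeBranch (p := 2 * termValue n a (List.ofFn t) α)
      (q := termValue n b (List.ofFn t) β) (r := -1 * termValue n a (List.ofFn t) α) ?_ hx⟩
    · simp [branchesAt, mt (hz ht0 ha α).2 hA, mt (hz ht0 hb β).2 hB, (hz ht0 hc γ).1 hC]
    · have h := subst_two_terms a b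
        (fun k => (vecs_gens (length_gapExps n α α _).le k).1) hx
      have h0 := (mul_eq_zero.1 (h.symm.trans (by linarith))).resolve_left
        (prod_ne_zero_iff.2 fun k _ => pow_ne_zero _ (hu k))
      rw [termValue_ofFn, termValue_ofFn]
      linarith
  · obtain ⟨t, ht, ht0, s, hs, hx⟩ := exists_full_parametrization ha hb hc hM haM hbM hcM hD
      hα hβ hγ (by rwa [term_replace_zero hA, term_replace_zero hB, term_replace_zero hC]) hsol
    refine ⟨_, ht, _, ?_, s, hs, hx⟩
    simp [branchesAt, mt (hz ht0 ha α).2 hA, mt (hz ht0 hb β).2 hB, mt (hz ht0 hc γ).2 hC]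

end Completeness

/-! ### Application to `reduce`. -/

theorem vec_map_exps (E : Equation) (f : ℕ × ℕ × ℕ → ℕ) (i : Fin E.numVars) :
    vec E.numVars (E.exps.map f) i = f (E.exps.get i) := by
  rw [vec, List.getD_eq_getElem _ _ (by simp)]
  simp

theorem vec_map_exps_le (E : Equation) {f : ℕ × ℕ × ℕ → ℕ} (hf : ∀ e, f e ≤ e.1 + e.2.1 + e.2.2)
    (i : Fin E.numVars) : vec E.numVars (E.exps.map f) i ≤ expBound E := by
  rw [vec_map_exps]
  refine (hf _).trans (Nat.le_succ_of_le ?_)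
  exact List.le_sum_of_mem (List.mem_map.2 ⟨_, List.get_mem _ _, rfl⟩)

theorem mem_solutions_iff (E : Equation) (x : Fin E.numVars → ℤ) :
    x ∈ E.solutions ↔ IsSolution E.numVars E.a E.b E.c (E.exps.map fun e => e.1)
      (E.exps.map fun e => e.2.1) (E.exps.map fun e => e.2.2) x := by
  simp only [IsSolution, vec_map_exps]
  rfl

theorem mem_reduce {E : Equation} {B : Branch} :
    B ∈ reduce E ↔ ∃ t ∈ intBox (2 * coeffNorm E ^ eqnBound E) E.numVars,
      B ∈ branchesAt (eqnBound E) E.numVars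
      (termValue E.numVars E.a t (E.exps.map fun e => e.1))
      (termValue E.numVars E.b t (E.exps.map fun e => e.2.1))
      (termValue E.numVars E.c t (E.exps.map fun e => e.2.2)) t
      (E.exps.map fun e => e.1) (E.exps.map fun e => e.2.1) (E.exps.map fun e => e.2.2) :=
  List.mem_flatMap

theorem recover_mem_solutions {E : Equation} (hE : E.Nondegenerate) {B : Branch}
    (hB : B ∈ reduce E) {s : B.eqn.Point} (hs : s ∈ B.eqn.solutions) :
    B.recover E.numVars s ∈ E.solutions := by
  obtain ⟨t, -, hB⟩ := mem_reduce.1 hB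
  exact (mem_solutions_iff E _).2 (recover_isSolution hE.1 hE.2.1 hE.2.2 hB hs)

theorem exists_recover_eq {E : Equation} (hE : E.Nondegenerate) {x : Fin E.numVars → ℤ}
    (hx : x ∈ E.solutions) :
    ∃ B ∈ reduce E, ∃ s ∈ B.eqn.primitiveSolutions, B.recover E.numVars s = x := by
  have hM : coeffNorm E ≠ 0 := by
    simpa [coeffNorm, and_assoc, Equation.Nondegenerate] using hE
  obtain ⟨t, ht, B, hB, s, hs, h⟩ := exists_branch_of_isSolution hE.1 hE.2.1 hE.2.2 hM
    (Dvd.intro _ (mul_assoc _ _ _).symm) (dvd_mul_of_dvd_left (dvd_mul_left _ _) _)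
    (dvd_mul_left _ _) (D := expBound E) (Nat.succ_le_succ (Nat.zero_le _))
    (vec_map_exps_le E fun e => by omega) (vec_map_exps_le E fun e => by omega)
    (vec_map_exps_le E fun e => by omega) ((mem_solutions_iff E x).1 hx)
  exact ⟨B, mem_reduce.2 ⟨t, ht, hB⟩, s, hs, h⟩

end ThreeMonomial

theorem theorem3p3 :
    ∃ reduce : ThreeMonomial.Equation → List ThreeMonomial.Branch,
      Computable reduce ∧
      ∀ E : ThreeMonomial.Equation, E.Nondegenerate →
        (∀ B ∈ reduce E, B.eqn.Nondegenerate) ∧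
        E.solutions = ⋃ B ∈ reduce E, B.recover E.numVars '' B.eqn.solutions ∧
        E.solutions = ⋃ B ∈ reduce E, B.recover E.numVars '' B.eqn.primitiveSolutions := by
  refine ⟨ThreeMonomial.reduce, ThreeMonomial.primrec_reduce.to_comp, fun E hE => ⟨?_, ?_, ?_⟩⟩
  · intro B hB
    obtain ⟨t, -, hB⟩ := ThreeMonomial.mem_reduce.1 hB
    exact ThreeMonomial.branchesAt_nondegenerate hB
  · refine Set.Subset.antisymm (fun x hx => ?_) (Set.iUnion₂_subset fun B hB => ?_)
    · obtain ⟨B, hB, s, hs, h⟩ := ThreeMonomial.exists_recover_eq hE hx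
      exact Set.mem_iUnion₂.2 ⟨B, hB, s, hs.1, h⟩
    · rintro _ ⟨s, hs, rfl⟩
      exact ThreeMonomial.recover_mem_solutions hE hB hs
  · refine Set.Subset.antisymm (fun x hx => ?_) (Set.iUnion₂_subset fun B hB => ?_)
    · obtain ⟨B, hB, s, hs, h⟩ := ThreeMonomial.exists_recover_eq hE hx
      exact Set.mem_iUnion₂.2 ⟨B, hB, s, hs, h⟩
    · rintro _ ⟨s, hs, rfl⟩
      exact ThreeMonomial.recover_mem_solutions hE hB hs.1
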